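/- Let $A\subset\tilde A$ be abelian groups and let $V$ be a strongly $A$-graded Möbius or conformal vertex algebra: $V=\coprod_{n\in\mathbb Z}V_{(n)}=\coprod_{\alpha\in A}V^{(\alpha)}$ is a vertex algebra with vertex operator map $Y(\cdot,x)$ and vacuum $\mathbf 1$, with compatible gradings, $V_{(n)}\cap V^{(\alpha)}$ finite-dimensional and zero for $n$ sufficiently negative, with $L(-1),L(0),L(1)$ as usual (given by an $\mathfrak{sl}(2)$-representation preserving each $V^{(\alpha)}$ in the Möbius case, by $L(n)=\omega_{n+1}$ with $\omega\in V_{(2)}\cap V^{(0)}$ in the conformal case), and $L(0)=n$ on $V_{(n)}$. Let $(W_1,Y_1)$ and $(W_2,Y_2)$ be strongly $\tilde A$-graded generalized $V$-modules (each $W_i$ is $\mathbb C$-graded by generalized $L(0)$-eigenspaces $(W_i)_{[n]}$ and compatibly $\tilde A$-graded, with $(W_i)_{[n]}\cap W_i^{(\beta)}$ finite-dimensional and $(W_i)_{[n+k]}\cap W_i^{(\beta)}=0$ for $k\in\mathbb Z$ sufficiently negative), and let $z\in\mathbb C^\times$. Write $\delta(x)=\sum_{n\in\mathbb Z}x^n$,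 powers of binomials being expanded in nonnegative powers of the second summand. For $v\in V_{(h)}$ and $f\in\mathbb C(t)$ set $$o(v\otimes f(t))=(-1)^h\sum_{m\ge 0}\frac{1}{m!}L(1)^m v\otimes t^{2h-m-2}f(t^{-1}),$$ extended linearly. For a generalized module $(W,Y_W)$, $Y_W(v,x)=\sum_n v_nx^{-n-1}$, let $\tau_W(v\otimes\sum_n a_nt^n)=\sum_n a_nv_n$ for $\sum_n a_nt^n\in\mathbb C((t))$, let $\iota_+:\mathbb C(t)\to\mathbb C((t))$ be the expansion at $t=0$ and $T_z f(t)=f(t+z)$. For $\xi\in V\otimes\mathbb C[t,t^{-1},(z^{-1}-t)^{-1}]$ and $\lambda\in(W_1\otimes W_2)^*$ define $\tau_{P(z)}(\xi)\lambda\in(W_1\otimes W_2)^*$ by $$(\tau_{P(z)}(\xi)\lambda)(w_1\otimes w_2)=\lambda\big(\tau_{W_1}(\iota_+T_z\,o(\xi))w_1\otimes w_2\big)+\lambda\big(w_1\otimes\tau_{W_2}(\iota_+\,o(\xi))w_2\big),$$ and put $Y'_{P(z)}(v,x)=\tau_{P(z)}(Y_t(v,x))$, where $Y_t(v,x)=\sum_{n\in\mathbb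 Z}(v\otimes t^n)x^{-n-1}$ and $\tau_{P(z)}$ is applied coefficientwise. Let $\lambda\in(W_1\otimes W_2)^*$ satisfy the $P(z)$-compatibility condition: (a) for all $v\in V$, $Y'_{P(z)}(v,x)\lambda$ involves only finitely many negative powers of $x$; (b) for all $v\in V$, $$\tau_{P(z)}\left(x_0^{-1}\delta\left(\frac{x_1^{-1}-z}{x_0}\right)Y_t(v,x_1)\right)\lambda=x_0^{-1}\delta\left(\frac{x_1^{-1}-z}{x_0}\right)Y'_{P(z)}(v,x_1)\lambda,$$ where on the left the coefficient of $x_0^{-n-1}x_1^{-m-1}$ in the argument of $\tau_{P(z)}$ is $v\otimes(t^{-1}-z)^nt^m$. Then for all $u,v\in V$ the Jacobi identity holds on $\lambda$ (all products of formal series below being well defined): $$x_0^{-1}\delta\left(\frac{x_1-x_2}{x_0}\right)Y'_{P(z)}(u,x_1)Y'_{P(z)}(v,x_2)\lambda-x_0^{-1}\delta\left(\frac{x_2-x_1}{-x_0}\right)Y'_{P(z)}(v,x_2)Y'_{P(z)}(u,x_1)\lambda=x_2^{-1}\delta\left(\frac{x_1-x_0}{x_2}\right)Y'_{P(z)}(Y(u,x_0)v,x_2)\lambda.$$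 -/

import Mathlib

namespace LogTensor

open scoped TensorProduct RatFunc

noncomputable section

/-! ### Formal series and formal delta functions

A formal series in commuting variables with coefficients in `U`, with arbitrary integral exponents,
is the function `G → U` of its coefficients, `G = ℤ × ℤ` or `G = ℤ × ℤ × ℤ` being the group of
exponent vectors. -/

section FormalSeries

variable {G U : Type*} [AddCommGroup G] [AddCommGroup U] [Module ℂ U]

/-- The product of a scalar formal series and a `U`-valued formal series exists: each coefficient
is a sum with only finitely many nonzero terms. -/
def MulExists (f : G → ℂ) (g : G → U) : Prop :=
  ∀ n, (Function.support fun k => f k • g (n - k)).Finite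

/-- The product of a scalar formal series and a `U`-valued formal series
(meaningful if `MulExists f g`). -/
def mulSeries (f : G → ℂ) (g : G → U) : G → U :=
  fun n => ∑ᶠ k, f k • g (n - k)

end FormalSeries

/-- The coefficient of `x ^ i * y ^ j` in `(x - y) ^ n = ∑ k ≥ 0, (-1) ^ k (n choose k) x ^ (n - k) y ^ k`,
`n` any integer (the expansion is in nonnegative powers of the second variable). -/
def subPowCoeff (n i j : ℤ) : ℂ :=
  if 0 ≤ j ∧ i + j = n then (-1) ^ j.toNat * ((Ring.choose n j.toNat : ℤ) : ℂ) else 0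

/-- `x₀⁻¹ δ((x₁ - x₂) / x₀) = ∑ n, x₀ ^ (-n - 1) (x₁ - x₂) ^ n`, exponents in the order
`(x₀, x₁, x₂)`. -/
def delta012 : ℤ × ℤ × ℤ → ℂ := fun e => subPowCoeff (-e.1 - 1) e.2.1 e.2.2

/-- `x₀⁻¹ δ((x₂ - x₁) / (-x₀)) = ∑ n, (-1) ^ n x₀ ^ (-n - 1) (x₂ - x₁) ^ n`, exponents in the order
`(x₀, x₁, x₂)`. -/
def delta021 : ℤ × ℤ × ℤ → ℂ :=
  fun e => (-1) ^ (-e.1 - 1) * subPowCoeff (-e.1 - 1) e.2.2 e.2.1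

/-- `x₂⁻¹ δ((x₁ - x₀) / x₂) = ∑ n, x₂ ^ (-n - 1) (x₁ - x₀) ^ n`, exponents in the order
`(x₀, x₁, x₂)`. -/
def delta210 : ℤ × ℤ × ℤ → ℂ := fun e => subPowCoeff (-e.2.2 - 1) e.2.1 e.1

/-- `x₀⁻¹ δ((x₁⁻¹ - z) / x₀) = ∑ n, x₀ ^ (-n - 1) (x₁⁻¹ - z) ^ n`, expanded in nonnegative powers
of `z`; exponents in the order `(x₀, x₁)`. In `(x₁⁻¹ - z) ^ n` the power `x₁ ^ e = (x₁⁻¹) ^ (-e)`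
occurs together with `z ^ (n + e)`. -/
def deltaInv (z : ℂ) : ℤ × ℤ → ℂ :=
  fun e => subPowCoeff (-e.1 - 1) (-e.2) (-e.1 - 1 + e.2) * z ^ (-e.1 - 1 + e.2)

section Jacobi

variable {V U : Type*} [AddCommGroup U] [Module ℂ U]

/-- The Jacobi identity for the vectors `u`, `v`, acting on `w`:
`x₀⁻¹ δ((x₁ - x₂) / x₀) Y(u, x₁) Y(v, x₂) w - x₀⁻¹ δ((x₂ - x₁) / (-x₀)) Y(v, x₂) Y(u, x₁) w`
`= x₂⁻¹ δ((x₁ - x₀) / x₂) Y(YV(u, x₀) v, x₂) w`,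
including that the three products of formal series exist. Here `Y u n` is the coefficient of
`x ^ (-n - 1)` in `Y(u, x)`, so the coefficient of `x ^ a` is `Y u (-a - 1)`. -/
def JacobiOn (YV : V → ℤ → V → V) (Y : V → ℤ → U → U) (u v : V) (w : U) : Prop :=
  let uv : ℤ × ℤ × ℤ → U := fun e =>
    if e.1 = 0 then Y u (-e.2.1 - 1) (Y v (-e.2.2 - 1) w) else 0
  let vu : ℤ × ℤ × ℤ → U := fun e =>
    if e.1 = 0 then Y v (-e.2.2 - 1) (Y u (-e.2.1 - 1) w) else 0
  let it : ℤ × ℤ × ℤ → U := fun e =>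
    if e.2.1 = 0 then Y (YV u (-e.1 - 1) v) (-e.2.2 - 1) w else 0
  MulExists delta012 uv ∧ MulExists delta021 vu ∧ MulExists delta210 it ∧
    mulSeries delta012 uv - mulSeries delta021 vu = mulSeries delta210 it

end Jacobi

/-! ### Vertex algebras and modules -/

section Vertex

/-- A family of subspaces is a grading: the space is their direct sum. -/
def IsGrading {ι W : Type*} [AddCommGroup W] [Module ℂ W] (p : ι → Submodule ℂ W) : Prop :=
  iSupIndep p ∧ ⨆ i, p i = ⊤

/-- A representation of `sl(2)` on `W`, given by the operators `L(-1)`, `L(0)`, `L(1)`. -/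
structure Sl2Rep (W : Type*) [AddCommGroup W] [Module ℂ W] where
  /-- `L(-1)` -/
  neg : Module.End ℂ W
  /-- `L(0)` -/
  zero : Module.End ℂ W
  /-- `L(1)` -/
  pos : Module.End ℂ W
  zero_neg : ⁅zero, neg⁆ = neg
  zero_pos : ⁅zero, pos⁆ = -pos
  neg_pos : ⁅neg, pos⁆ = -(2 : ℂ) • zero

variable {V W : Type*} [AddCommGroup V] [Module ℂ V] [AddCommGroup W] [Module ℂ W]

/-- `mode Y v n` is the operator `v_n` in `Y(v, x) = ∑ n, v_n x ^ (-n - 1)`. -/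
abbrev mode (Y : V →ₗ[ℂ] VertexOperator ℂ W) (v : V) (n : ℤ) : Module.End ℂ W :=
  VertexOperator.ncoeff (Y v) n

/-- The Virasoro algebra relations with central charge `c`. -/
def VirasoroRelations (L : ℤ → Module.End ℂ W) (c : ℂ) : Prop :=
  ∀ m n : ℤ, ⁅L m, L n⁆ = ((m : ℂ) - n) • L (m + n) +
    (if m + n = 0 then ((m : ℂ) ^ 3 - m) / 12 * c else 0) • (1 : Module.End ℂ W)

/-- The bracket formulas
`[L(-1), Y(v, x)] = Y(L(-1)v, x)`, `[L(0), Y(v, x)] = Y(L(0)v, x) + x Y(L(-1)v, x)`,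
`[L(1), Y(v, x)] = Y(L(1)v, x) + 2 x Y(L(0)v, x) + x ^ 2 Y(L(-1)v, x)`, in components. -/
def Sl2Brackets (LV : Sl2Rep V) (LW : Sl2Rep W) (Y : V →ₗ[ℂ] VertexOperator ℂ W) : Prop :=
  ∀ (v : V) (n : ℤ),
    ⁅LW.neg, mode Y v n⁆ = mode Y (LV.neg v) n ∧
    ⁅LW.zero, mode Y v n⁆ = mode Y (LV.zero v) n + mode Y (LV.neg v) (n + 1) ∧
    ⁅LW.pos, mode Y v n⁆ = mode Y (LV.pos v) n + (2 : ℂ) • mode Y (LV.zero v) (n + 1) +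
      mode Y (LV.neg v) (n + 2)

/-- The part common to strongly `A`-graded Möbius vertex algebras and strongly `A`-graded conformal
vertex algebras; `IsMobius` and `IsConformal` below complete it to either notion. (In the conformal
case the `sl(2)`-relations and `L_mem_ch` are consequences of the axioms.) That `Y(u, x)v` has only
finitely many negative powers of `x` is part of Mathlib's notion of a vertex operator. -/
structure StronglyGradedVertexAlgebra {At : Type*} [AddCommGroup At] (A : AddSubgroup At)
    (V : Type*) [AddCommGroup V] [Module ℂ V] where
  /-- The vertex operator map. -/
  Y : V →ₗ[ℂ] VertexOperator ℂ V
  /-- The vacuum vector. -/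
  vac : V
  /-- The weight spaces `V_(n)`. -/
  wt : ℤ → Submodule ℂ V
  /-- The homogeneous subspaces `V^(α)`. -/
  ch : A → Submodule ℂ V
  /-- The operators `L(-1)`, `L(0)`, `L(1)`. -/
  L : Sl2Rep V
  wt_grading : IsGrading wt
  vac_mem_wt : vac ∈ wt 0
  vacuum : ∀ (n : ℤ) (v : V), mode Y vac n v = if n = -1 then v else 0
  creation : ∀ v : V, mode Y v (-1) vac = v ∧ ∀ n : ℤ, 0 ≤ n → mode Y v n vac = 0
  jacobi : ∀ u v w : V, JacobiOn (fun a n b => mode Y a n b) (fun a n b => mode Y a n b) u v w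
  /-- `d/dx Y(v, x) = Y(L(-1)v, x)` -/
  derivative : ∀ (v : V) (n : ℤ), mode Y (L.neg v) n = -(n : ℂ) • mode Y v (n - 1)
  L0_wt : ∀ (n : ℤ), ∀ v ∈ wt n, L.zero v = (n : ℂ) • v
  ch_grading : IsGrading ch
  ch_compat : ∀ α, ch α = ⨆ n, wt n ⊓ ch α
  lower : ∀ α, ∃ N : ℤ, ∀ n < N, wt n ⊓ ch α = ⊥
  finite : ∀ α n, FiniteDimensional ℂ ↥(wt n ⊓ ch α)
  vac_mem_ch : vac ∈ ch 0
  mode_mem_ch : ∀ α β, ∀ u ∈ ch α, ∀ v ∈ ch β, ∀ n : ℤ, mode Y u n v ∈ ch (α + β)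
  L_mem_ch : ∀ α, ∀ v ∈ ch α, L.neg v ∈ ch α ∧ L.zero v ∈ ch α ∧ L.pos v ∈ ch α

variable {At : Type*} [AddCommGroup At] {A : AddSubgroup At}

/-- The remaining axioms of a strongly graded Möbius vertex algebra. -/
def StronglyGradedVertexAlgebra.IsMobius (VA : StronglyGradedVertexAlgebra A V) : Prop :=
  Sl2Brackets VA.L VA.L VA.Y

/-- The remaining axioms of a strongly graded conformal vertex algebra with conformal vector `ω` and
central charge `c`: here `L(n) = ω_{n+1}`. -/
def StronglyGradedVertexAlgebra.IsConformal (VA : StronglyGradedVertexAlgebra A V) (ω : V) (c : ℂ) :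
    Prop :=
  ω ∈ VA.wt 2 ∧ ω ∈ VA.ch 0 ∧
  VA.L.neg = mode VA.Y ω 0 ∧ VA.L.zero = mode VA.Y ω 1 ∧ VA.L.pos = mode VA.Y ω 2 ∧
  VirasoroRelations (fun n => mode VA.Y ω (n + 1)) c

/-- The part common to strongly graded generalized modules for Möbius and for conformal vertex
algebras. Here the second grading is by the whole group `At`, which contains `A`. -/
structure StronglyGradedGenModule (VA : StronglyGradedVertexAlgebra A V)
    (W : Type*) [AddCommGroup W] [Module ℂ W] where
  /-- The vertex operator map. -/
  Y : V →ₗ[ℂ] VertexOperator ℂ W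
  /-- The generalized weight spaces `W_[n]`. -/
  wt : ℂ → Submodule ℂ W
  /-- The homogeneous subspaces `W^(β)`. -/
  ch : At → Submodule ℂ W
  /-- The operators `L(-1)`, `L(0)`, `L(1)` on `W`. -/
  L : Sl2Rep W
  wt_grading : IsGrading wt
  vacuum : ∀ (n : ℤ) (w : W), mode Y VA.vac n w = if n = -1 then w else 0
  jacobi : ∀ (u v : V) (w : W),
    JacobiOn (fun a n b => mode VA.Y a n b) (fun a n b => mode Y a n b) u v w
  /-- `d/dx Y(v, x) = Y(L(-1)v, x)` -/
  derivative : ∀ (v : V) (n : ℤ), mode Y (VA.L.neg v) n = -(n : ℂ) • mode Y v (n - 1)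
  /-- `W_[n]` consists of generalized eigenvectors of `L(0)` with eigenvalue `n`. -/
  L0_wt : ∀ (n : ℂ), ∀ w ∈ wt n, ∃ m : ℕ, ((L.zero - n • (1 : Module.End ℂ W)) ^ m) w = 0
  ch_grading : IsGrading ch
  ch_compat : ∀ β, ch β = ⨆ n, wt n ⊓ ch β
  lower : ∀ β n, ∃ N : ℤ, ∀ k : ℤ, k < N → wt (n + k) ⊓ ch β = ⊥
  finite : ∀ β n, FiniteDimensional ℂ ↥(wt n ⊓ ch β)
  mode_mem_ch : ∀ (α : A) (β : At), ∀ v ∈ VA.ch α, ∀ w ∈ ch β, ∀ n : ℤ,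
    mode Y v n w ∈ ch (α + β)
  L_mem_ch : ∀ β, ∀ w ∈ ch β, L.neg w ∈ ch β ∧ L.zero w ∈ ch β ∧ L.pos w ∈ ch β

/-- The remaining axioms of a generalized module for a Möbius vertex algebra. -/
def StronglyGradedGenModule.IsMobius {VA : StronglyGradedVertexAlgebra A V}
    (M : StronglyGradedGenModule VA W) : Prop :=
  Sl2Brackets VA.L M.L M.Y

/-- The remaining axioms of a generalized module for a conformal vertex algebra with conformal
vector `ω` and central charge `c`. -/
def StronglyGradedGenModule.IsConformal {VA : StronglyGradedVertexAlgebra A V}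
    (M : StronglyGradedGenModule VA W) (ω : V) (c : ℂ) : Prop :=
  M.L.neg = mode M.Y ω 0 ∧ M.L.zero = mode M.Y ω 1 ∧ M.L.pos = mode M.Y ω 2 ∧
  VirasoroRelations (fun n => mode M.Y ω (n + 1)) c

end Vertex

/-! ### Rational functions -/

section RatFunc

/-- The substitution `f(t) ↦ f(a)` on `ℂ(t)`, for a nonconstant rational function `a`. -/
def subst (a : RatFunc ℂ) (ha : Transcendental ℂ a) : RatFunc ℂ →ₐ[ℂ] RatFunc ℂ :=
  (IntermediateField.val _).comp (RatFunc.algEquivOfTranscendental a ha).toAlgHom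

theorem transcendental_X_add (a : ℂ) : Transcendental ℂ (RatFunc.X + RatFunc.C a : RatFunc ℂ) := by
  intro h
  have h2 : IsAlgebraic ℂ (RatFunc.C a : RatFunc ℂ) := by
    rw [← RatFunc.algebraMap_eq_C]; exact isAlgebraic_algebraMap a
  exact RatFunc.transcendental_X (by simpa using h.sub h2)

theorem transcendental_X_inv : Transcendental ℂ (RatFunc.X⁻¹ : RatFunc ℂ) := fun h =>
  RatFunc.transcendental_X (IsAlgebraic.inv_iff.mp h)

/-- `T_a : f(t) ↦ f(t + a)` -/
def translate (a : ℂ) : RatFunc ℂ →ₐ[ℂ] RatFunc ℂ :=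
  subst (RatFunc.X + RatFunc.C a) (transcendental_X_add a)

/-- `f(t) ↦ f(t⁻¹)` -/
def invert : RatFunc ℂ →ₐ[ℂ] RatFunc ℂ := subst RatFunc.X⁻¹ transcendental_X_inv

/-- `ι₊ : ℂ(t) → ℂ((t))`, the expansion at `t = 0`. -/
def iotaPlus : RatFunc ℂ →ₗ[ℂ] LaurentSeries ℂ where
  toFun f := algebraMap (RatFunc ℂ) (LaurentSeries ℂ) f
  map_add' := map_add _
  map_smul' r f := by
    have h : algebraMap (RatFunc ℂ) (LaurentSeries ℂ) (RatFunc.C r) = HahnSeries.C r := by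
      rw [← RatFunc.algebraMap_C,
        ← IsScalarTower.algebraMap_apply (Polynomial ℂ) (RatFunc ℂ) (LaurentSeries ℂ)]
      simp
    rw [RatFunc.smul_eq_C_mul, map_mul, h, RingHom.id_apply, HahnSeries.C_mul_eq_smul]

end RatFunc

/-! ### The action `τ_W` of `V ⊗ ℂ((t))` on a module -/

section TauW

variable {V W : Type*} [AddCommGroup V] [Module ℂ V] [AddCommGroup W] [Module ℂ W]

theorem tauW_finite (Y : V →ₗ[ℂ] VertexOperator ℂ W) (v : V) (f : LaurentSeries ℂ) (w : W) :
    (Function.support fun n : ℤ => f.coeff n • mode Y v n w).Finite := by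
  refine (Set.finite_Icc f.order
    (-((HahnModule.of ℂ).symm (Y v w)).order - 1)).subset fun n hn => ?_
  rw [Function.mem_support] at hn
  refine ⟨?_, ?_⟩
  · by_contra h
    exact hn (by rw [HahnSeries.coeff_eq_zero_of_lt_order (not_le.mp h), zero_smul])
  · by_contra h
    exact hn (by rw [VertexOperator.ncoeff_eq_zero_of_lt_order (Y v) n w (by omega), smul_zero])

/-- `τ_W(v ⊗ ∑ n, a_n t ^ n) = ∑ n, a_n v_n` -/
def tauW (Y : V →ₗ[ℂ] VertexOperator ℂ W) : V ⊗[ℂ] LaurentSeries ℂ →ₗ[ℂ] Module.End ℂ W :=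
  TensorProduct.lift <| LinearMap.mk₂ ℂ
    (fun v f =>
      { toFun := fun w => ∑ᶠ n : ℤ, f.coeff n • mode Y v n w
        map_add' := fun w w' => by
          rw [← finsum_add_distrib (tauW_finite Y v f w) (tauW_finite Y v f w')]
          simp only [map_add, smul_add]
        map_smul' := fun r w => by
          rw [RingHom.id_apply, smul_finsum' r (tauW_finite Y v f w)]
          simp only [map_smul, smul_comm r] })
    (fun v v' f => LinearMap.ext fun w => by
      change _ = (∑ᶠ n : ℤ, f.coeff n • mode Y v n w) + ∑ᶠ n : ℤ, f.coeff n • mode Y v' n w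
      rw [← finsum_add_distrib (tauW_finite Y v f w) (tauW_finite Y v' f w)]
      simp [mode])
    (fun r v f => LinearMap.ext fun w => by
      change _ = r • ∑ᶠ n : ℤ, f.coeff n • mode Y v n w
      rw [smul_finsum' r (tauW_finite Y v f w)]
      simp [mode, smul_comm r])
    (fun v f f' => LinearMap.ext fun w => by
      change _ = (∑ᶠ n : ℤ, f.coeff n • mode Y v n w) + ∑ᶠ n : ℤ, f'.coeff n • mode Y v n w
      rw [← finsum_add_distrib (tauW_finite Y v f w) (tauW_finite Y v f' w)]
      simp [add_smul])
    (fun r v f => LinearMap.ext fun w => by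
      change _ = r • ∑ᶠ n : ℤ, f.coeff n • mode Y v n w
      rw [smul_finsum' r (tauW_finite Y v f w)]
      simp [mul_smul])

end TauW

/-! ### The opposite-operator map and the action `τ_{P(z)}` -/

section TauP

variable {At : Type*} [AddCommGroup At] {A : AddSubgroup At}
  {V : Type*} [AddCommGroup V] [Module ℂ V]

namespace StronglyGradedVertexAlgebra

variable (VA : StronglyGradedVertexAlgebra A V)

/-- The direct sum of the weight spaces is `V`. -/
def weightEquiv : DirectSum ℤ (fun n => VA.wt n) ≃ₗ[ℂ] V :=
  LinearEquiv.ofBijective (DirectSum.coeLinearMap VA.wt)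
    ((DirectSum.isInternal_submodule_iff_iSupIndep_and_iSup_eq_top VA.wt).mpr VA.wt_grading)

/-- The linear map on `V` that agrees with `F h` on the weight space `V_(h)`. -/
def ofWeights {U : Type*} [AddCommGroup U] [Module ℂ U] (F : ℤ → V →ₗ[ℂ] U) : V →ₗ[ℂ] U :=
  DirectSum.toModule ℂ ℤ U (fun h => F h ∘ₗ (VA.wt h).subtype) ∘ₗ VA.weightEquiv.symm.toLinearMap

theorem mem_wt_of_L0 (n : ℤ) (v : V) (hv : VA.L.zero v = (n : ℂ) • v) : v ∈ VA.wt n := by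
  have hle : ∀ k : ℤ, VA.wt k ≤ VA.L.zero.eigenspace (k : ℂ) := fun k w hw =>
    Module.End.mem_eigenspace_iff.mpr (VA.L0_wt k w hw)
  have hv' : v ∈ VA.wt n ⊔ ⨆ (j) (_ : j ≠ n), VA.wt j := by
    have : (⊤ : Submodule ℂ V) ≤ VA.wt n ⊔ ⨆ (j) (_ : j ≠ n), VA.wt j := by
      rw [← VA.wt_grading.2]
      refine iSup_le fun j => ?_
      by_cases hj : j = n
      · subst hj; exact le_sup_left
      · exact le_sup_of_le_right (le_iSup₂_of_le j hj le_rfl)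
    exact this trivial
  obtain ⟨a, ha, b, hb, rfl⟩ := Submodule.mem_sup.mp hv'
  have hb1 : b ∈ VA.L.zero.eigenspace (n : ℂ) := by
    have := Submodule.sub_mem _ (Module.End.mem_eigenspace_iff.mpr hv) (hle n ha)
    simpa using this
  have hb2 : b ∈ ⨆ (μ) (_ : μ ≠ (n : ℂ)), VA.L.zero.eigenspace μ :=
    (iSup₂_le fun j hj => le_iSup₂_of_le (j : ℂ) (by exact_mod_cast hj) (hle j) :
      (⨆ (j) (_ : j ≠ n), VA.wt j) ≤ _) hb
  have hb0 : b = 0 := Submodule.disjoint_def.mp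
    (VA.L.zero.eigenspaces_iSupIndep (n : ℂ)) b hb1 hb2
  simpa [hb0] using ha

theorem pow_L1_mem (n : ℤ) (α : A) (v : V) (hv : v ∈ VA.wt n ⊓ VA.ch α) (m : ℕ) :
    (VA.L.pos ^ m) v ∈ VA.wt (n - m) ⊓ VA.ch α := by
  induction m with
  | zero => simpa using hv
  | succ m ih =>
    rw [pow_succ', Module.End.mul_apply]
    refine ⟨VA.mem_wt_of_L0 _ _ ?_, (VA.L_mem_ch α _ ih.2).2.2⟩
    have h := congrArg (fun T : Module.End ℂ V => T ((VA.L.pos ^ m) v)) VA.L.zero_pos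
    simp only [Ring.lie_def, LinearMap.sub_apply, Module.End.mul_apply, LinearMap.neg_apply,
      VA.L0_wt _ _ ih.1, map_smul] at h
    rw [sub_eq_iff_eq_add] at h
    rw [h]
    push_cast
    module

/-- `L(1)` is locally nilpotent on `V`. -/
theorem L1_nilpotent (v : V) : ∃ N : ℕ, ∀ m, N ≤ m → (VA.L.pos ^ m) v = 0 := by
  have hadd : ∀ x y : V, (∃ N : ℕ, ∀ m, N ≤ m → (VA.L.pos ^ m) x = 0) →
      (∃ N : ℕ, ∀ m, N ≤ m → (VA.L.pos ^ m) y = 0) →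
      ∃ N : ℕ, ∀ m, N ≤ m → (VA.L.pos ^ m) (x + y) = 0 := by
    rintro x y ⟨N, hN⟩ ⟨N', hN'⟩
    exact ⟨max N N', fun m hm => by
      rw [map_add, hN m (le_of_max_le_left hm), hN' m (le_of_max_le_right hm), add_zero]⟩
  have hv : v ∈ ⨆ α, VA.ch α := by rw [VA.ch_grading.2]; trivial
  induction hv using Submodule.iSup_induction' with
  | zero => exact ⟨0, fun m _ => map_zero _⟩
  | add x y _ _ hx hy => exact hadd x y hx hy
  | mem α x hx =>
    rw [VA.ch_compat α] at hx
    induction hx using Submodule.iSup_induction' with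
    | zero => exact ⟨0, fun m _ => map_zero _⟩
    | add x y _ _ hx hy => exact hadd x y hx hy
    | mem n x hx =>
      obtain ⟨N, hN⟩ := VA.lower α
      refine ⟨(n - N + 1).toNat, fun m hm => ?_⟩
      have h := VA.pow_L1_mem n α x hx m
      rw [hN (n - m) (by omega)] at h
      exact (Submodule.mem_bot ℂ).mp h

/-- The term of index `m` of `(-1) ^ h ∑ m, (1 / m!) L(1) ^ m v ⊗ t ^ (2h - m - 2)`. -/
def oppTerm (h : ℤ) (v : V) (m : ℕ) : V ⊗[ℂ] RatFunc ℂ :=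
  ((-1 : ℂ) ^ h * (m.factorial : ℂ)⁻¹) •
    ((VA.L.pos ^ m) v ⊗ₜ[ℂ] ((RatFunc.X : RatFunc ℂ) ^ (2 * h - m - 2)))

theorem oppTerm_finite (h : ℤ) (v : V) : (Function.support (VA.oppTerm h v)).Finite := by
  obtain ⟨N, hN⟩ := VA.L1_nilpotent v
  refine (Set.finite_lt_nat N).subset fun m hm => ?_
  by_contra hlt
  exact hm (by simp [oppTerm, hN m (not_lt.mp hlt)])

/-- The linear map `v ↦ v^o = e ^ (t⁻¹ L(1)) (-t ^ 2) ^ L(0) v t⁻²`, that is,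
`v^o = (-1) ^ h ∑ m, (1 / m!) L(1) ^ m v ⊗ t ^ (2h - m - 2)` for `v ∈ V_(h)`. -/
def oppVec : V →ₗ[ℂ] V ⊗[ℂ] RatFunc ℂ :=
  VA.ofWeights fun h =>
    { toFun := fun v => ∑ᶠ m : ℕ, VA.oppTerm h v m
      map_add' := fun v v' => by
        rw [← finsum_add_distrib (VA.oppTerm_finite h v) (VA.oppTerm_finite h v')]
        simp only [oppTerm, map_add, TensorProduct.add_tmul, smul_add]
      map_smul' := fun r v => by
        rw [RingHom.id_apply, smul_finsum' r (VA.oppTerm_finite h v)]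
        simp only [oppTerm, map_smul, TensorProduct.smul_tmul', smul_comm r] }

/-- The opposite-operator map `o : v ⊗ f(t) ↦ v^o f(t⁻¹)`, on rational functions. It commutes with
expanding rational functions: `o ∘ ι₊ = ι₋ ∘ o` and `o ∘ ι₋ = ι₊ ∘ o`. -/
def opp : V ⊗[ℂ] RatFunc ℂ →ₗ[ℂ] V ⊗[ℂ] RatFunc ℂ :=
  TensorProduct.lift <| LinearMap.flip
    ((LinearMap.lcomp ℂ (V ⊗[ℂ] RatFunc ℂ) VA.oppVec) ∘ₗ LinearMap.lTensorHom V ∘ₗ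
      LinearMap.mul ℂ (RatFunc ℂ) ∘ₗ invert.toLinearMap)

theorem opp_tmul (v : V) (f : RatFunc ℂ) :
    VA.opp (v ⊗ₜ f) = LinearMap.lTensor V (LinearMap.mul ℂ (RatFunc ℂ) (invert f)) (VA.oppVec v) :=
  rfl

end StronglyGradedVertexAlgebra

variable {VA : StronglyGradedVertexAlgebra A V}
  {W₁ W₂ : Type*} [AddCommGroup W₁] [Module ℂ W₁] [AddCommGroup W₂] [Module ℂ W₂]

/-- The action `τ_{P(z)}` on `(W₁ ⊗ W₂)^*`:
`(τ_{P(z)}(ξ)λ)(w₁ ⊗ w₂) = λ(τ_{W₁}((ι₊ ∘ T_z ∘ ι₋⁻¹ ∘ o) ξ) w₁ ⊗ w₂)`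
`+ λ(w₁ ⊗ τ_{W₂}((ι₊ ∘ ι₋⁻¹ ∘ o) ξ) w₂)`.
An element `ξ` of `V ⊗ ι₊ ℂ[t, t⁻¹, (z⁻¹ - t)⁻¹]` is given by the element of
`V ⊗ ℂ[t, t⁻¹, (z⁻¹ - t)⁻¹]` whose expansion it is (`ι₊` is injective); then `ι₋⁻¹ ∘ o` is the map
`opp`. The formula makes sense on all of `V ⊗ ℂ(t)`. -/
def tauP (z : ℂ) (M₁ : StronglyGradedGenModule VA W₁) (M₂ : StronglyGradedGenModule VA W₂)
    (ξ : V ⊗[ℂ] RatFunc ℂ) (lam : Module.Dual ℂ (W₁ ⊗[ℂ] W₂)) : Module.Dual ℂ (W₁ ⊗[ℂ] W₂) :=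
  lam ∘ₗ LinearMap.rTensor W₂
      (tauW M₁.Y (LinearMap.lTensor V (iotaPlus ∘ₗ (translate z).toLinearMap)
        (VA.opp ξ))) +
    lam ∘ₗ LinearMap.lTensor W₁
      (tauW M₂.Y (LinearMap.lTensor V iotaPlus (VA.opp ξ)))

/-- The component operators of `Y'_{P(z)}(v, x) = τ_{P(z)}(Y_t(v, x))`, where
`Y_t(v, x) = ∑ n, (v ⊗ t ^ n) x ^ (-n - 1)`: the coefficient of `x ^ (-n - 1)`. -/
def YP (z : ℂ) (M₁ : StronglyGradedGenModule VA W₁) (M₂ : StronglyGradedGenModule VA W₂)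
    (v : V) (n : ℤ) (lam : Module.Dual ℂ (W₁ ⊗[ℂ] W₂)) : Module.Dual ℂ (W₁ ⊗[ℂ] W₂) :=
  tauP z M₁ M₂ (v ⊗ₜ[ℂ] ((RatFunc.X : RatFunc ℂ) ^ n)) lam

/-- The series `x₀⁻¹ δ((x₁⁻¹ - z) / x₀) Y_t(v, x₁)` with coefficients in
`V ⊗ ℂ[t, t⁻¹, (z⁻¹ - t)⁻¹]`: the coefficient of `x₀ ^ (-n - 1) x₁ ^ (-m - 1)` is
`v ⊗ (t⁻¹ - z) ^ n t ^ m`. -/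
def deltaYt (z : ℂ) (v : V) : ℤ × ℤ → V ⊗[ℂ] RatFunc ℂ := fun e =>
  v ⊗ₜ[ℂ] (((RatFunc.X : RatFunc ℂ)⁻¹ - RatFunc.C z) ^ (-e.1 - 1) * RatFunc.X ^ (-e.2 - 1))

/-- The `P(z)`-lower truncation condition: for all `v`, the series `Y'_{P(z)}(v, x) λ` has only
finitely many negative powers of `x`. -/
def LowerTruncation (z : ℂ) (M₁ : StronglyGradedGenModule VA W₁)
    (M₂ : StronglyGradedGenModule VA W₂) (lam : Module.Dual ℂ (W₁ ⊗[ℂ] W₂)) : Prop :=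
  ∀ v : V, ∃ N : ℤ, ∀ n : ℤ, N ≤ n → YP z M₁ M₂ v n lam = 0

/-- The `P(z)`-compatibility condition: (a) lower truncation and (b)
`τ_{P(z)}(x₀⁻¹ δ((x₁⁻¹ - z) / x₀) Y_t(v, x₁)) λ = x₀⁻¹ δ((x₁⁻¹ - z) / x₀) Y'_{P(z)}(v, x₁) λ`
for all `v` (by (a), the product on the right exists). -/
def Compatible (z : ℂ) (M₁ : StronglyGradedGenModule VA W₁)
    (M₂ : StronglyGradedGenModule VA W₂) (lam : Module.Dual ℂ (W₁ ⊗[ℂ] W₂)) : Prop :=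
  LowerTruncation z M₁ M₂ lam ∧
  ∀ v : V, (fun e => tauP z M₁ M₂ (deltaYt z v e) lam) =
    mulSeries (deltaInv z)
      (fun e : ℤ × ℤ => if e.1 = 0 then YP z M₁ M₂ v (-e.2 - 1) lam else 0)

end TauP

end

end LogTensor

/-! Pairing the Jacobi identity with `t₁ ^ m t₂ ^ n (t₁ - t₂) ^ l` turns it into identities between
finite sums (`jacobiOn_iff`), to be checked at `w₁ ⊗ w₂`. By `tauP_apply_tmul`, a component of
`Y'_{P(z)}` is an opposite operator on `W₁`, with local coordinate `t⁻¹ - z`, plus one on `W₂`, with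
local coordinate `t⁻¹`. A product of two components therefore has four parts
(`Compatible.eventually_sum_YP_YP`).

If both factors act on `W₂`, the sums already have the form of a Jacobi identity for opposite
operators. If both act on `W₁`, the expansion should run in the local coordinates, `(t₁ - t₂) ^ l =
(t₁ t₂) ^ l ((t₂⁻¹ - z) - (t₁⁻¹ - z)) ^ l`, whereas the product applied to `λ` expands in powers of
`t₂`. Compatibility is exactly what permits the change of expansion (`Compatible.sum_YP_oppAct`). In
the mixed parts, with `t₁` near `z⁻¹` and `t₂` near `∞`, the difference `t₂⁻¹ - t₁⁻¹` is near `-z ≠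
0`. The two orders of the product thus expand one function that is regular up to powers of `t₂`, and
the mixed parts cancel (`eventually_sum_oppAct_tmul_oppAct`).

What is left is the Jacobi identity for opposite operators on each module
(`eventually_oppAct_jacobi`), whose right sides add up to the iterate term. It follows from the
Jacobi identity of the module weighted by Laurent series (`eventually_tauW_jacobi`), the conjugation
of `Y(u, x)` by `e ^ (y L(1))` on `V` (`divL1_mode`), and a binomial convolution
(`sum_neg_one_pow_mul_binom_mul_binom`).

All sums are cut at some `J`, and each identity is asserted for all large `J`, so that finitely many
truncations can be merged. -/

namespace LogTensor

open scoped TensorProduct RatFunc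
open Finset Filter

noncomputable section

/-! ### Binomial coefficients with integral upper index. -/

section Binomial

/-- The binomial coefficient `n choose k` as a complex number, for an integer `n`. -/
def binom (n : ℤ) (k : ℕ) : ℂ := ((Ring.choose n k : ℤ) : ℂ)

@[simp] theorem binom_zero_right (n : ℤ) : binom n 0 = 1 := by simp [binom]

theorem binom_zero_succ (k : ℕ) : binom 0 (k + 1) = 0 := by simp [binom]

theorem binom_succ_succ (n : ℤ) (k : ℕ) :
    binom (n + 1) (k + 1) = binom n k + binom n (k + 1) := by
  simp [binom, Ring.choose_succ_succ]

theorem binom_natCast (n k : ℕ) : binom n k = n.choose k := by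
  simp [binom, Ring.choose_natCast]

theorem binom_mul_binom_sub (l : ℤ) (q k : ℕ) :
    binom l q * binom (l - q) k = ((q + k).choose q : ℂ) * binom l (q + k) := by
  have h := Ring.choose_add_smul_choose (l - q) k q
  rw [sub_add_cancel, add_comm k q] at h
  simp only [binom]
  rw [← Int.cast_mul, ← h]
  simp

theorem binom_mul_binom_sub_comm (l : ℤ) (q k : ℕ) :
    binom l q * binom (l - q) k = binom l k * binom (l - k) q := by
  rw [binom_mul_binom_sub, binom_mul_binom_sub, add_comm k q, Nat.choose_symm_add]

theorem succ_mul_binom_succ (n : ℤ) (k : ℕ) :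
    ((k : ℂ) + 1) * binom n (k + 1) = ((n : ℂ) - k) * binom n k := by
  have h := binom_mul_binom_sub n k 1
  rw [Nat.choose_succ_self_right] at h
  have h1 : binom (n - k) 1 = (n : ℂ) - k := by simp [binom]
  rw [h1] at h
  push_cast at h
  rw [← h, mul_comm]

theorem neg_one_pow_mul_binom (m : ℤ) (j : ℕ) :
    (-1) ^ j * binom (j - m - 1) j = binom m j := by
  have h := Ring.choose_neg (-m) j
  rw [neg_neg] at h
  unfold binom
  rw [h, show (j : ℤ) - m - 1 = -m + j - 1 by ring]
  simp [Units.smul_def]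

/-- This is the coefficient of `x ^ r` in `(1 + x) ^ M (1 - x / (1 + x)) ^ m = (1 + x) ^ (M - m)`.
The induction on `r` shows that the difference of the two sides does not change under `m ↦ m + 1`;
at `m = 0` it vanishes. -/
theorem sum_neg_one_pow_mul_binom_mul_binom (r : ℕ) : ∀ m M : ℤ,
    ∑ j ∈ range (r + 1), (-1) ^ j * binom m j * binom (M - j) (r - j) = binom (M - m) r := by
  induction r with
  | zero => intro m M; simp
  | succ r ih =>
    intro m M
    have step : ∀ m : ℤ,
        ∑ j ∈ range (r + 2), (-1) ^ j * binom (m + 1) j * binom (M - j) (r + 1 - j) -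
            binom (M - (m + 1)) (r + 1) =
          ∑ j ∈ range (r + 2), (-1) ^ j * binom m j * binom (M - j) (r + 1 - j) -
            binom (M - m) (r + 1) := by
      intro m
      have h1 : ∑ j ∈ range (r + 2), (-1) ^ j * binom (m + 1) j * binom (M - j) (r + 1 - j) =
          ∑ j ∈ range (r + 2), (-1) ^ j * binom m j * binom (M - j) (r + 1 - j) -
            ∑ j ∈ range (r + 1), (-1) ^ j * binom m j * binom (M - 1 - j) (r - j) := by
        rw [sum_range_succ' _ (r + 1), sum_range_succ' _ (r + 1)]
        simp only [binom_succ_succ, Nat.add_sub_add_right, binom_zero_right]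
        rw [add_sub_right_comm, ← sum_sub_distrib]
        congr 1
        refine sum_congr rfl fun j _ => ?_
        rw [show M - ((j + 1 : ℕ) : ℤ) = M - 1 - j by push_cast; ring]
        ring
      have h2 := binom_succ_succ (M - (m + 1)) r
      rw [h1, ih m (M - 1)]
      rw [show M - (m + 1) + 1 = M - m by ring] at h2
      rw [h2, show M - 1 - m = M - (m + 1) by ring]
      ring
    have base : ∑ j ∈ range (r + 2), (-1) ^ j * binom 0 j * binom (M - j) (r + 1 - j) -
        binom (M - 0) (r + 1) = 0 := by
      rw [sum_range_succ']
      simp [binom_zero_succ]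
    have key : ∑ j ∈ range (r + 2), (-1) ^ j * binom m j * binom (M - j) (r + 1 - j) -
        binom (M - m) (r + 1) = 0 := by
      induction m using Int.induction_on with
      | zero => exact base
      | succ i hi => rw [step]; exact hi
      | pred i hi => rw [← step, sub_add_cancel]; exact hi
    exact sub_eq_zero.mp key

end Binomial

/-! ### The Jacobi identity in components. -/

section Jacobi

variable {ι U : Type*} [AddCommGroup U]

theorem finsum_eq_sum_range_comp {φ : ℕ → ι} (hφ : Function.Injective φ) {F : ι → U} {J : ℕ}
    (h : ∀ i, F i ≠ 0 → ∃ j < J, φ j = i) :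
    F.support.Finite ∧ ∑ᶠ i, F i = ∑ j ∈ range J, F (φ j) := by
  have hs : F.support ⊆ ((range J).map ⟨φ, hφ⟩ : Finset ι) := by
    intro i hi
    obtain ⟨j, hj, rfl⟩ := h i hi
    simpa using ⟨j, hj, rfl⟩
  exact ⟨(Finset.finite_toSet _).subset hs, by
    rw [finsum_eq_sum_of_support_subset _ hs, sum_map]; rfl⟩

theorem sum_range_eq_of_eq_zero {F : ℕ → U} {J J' : ℕ} (hJ : J ≤ J')
    (h : ∀ j, J ≤ j → F j = 0) : ∑ j ∈ range J', F j = ∑ j ∈ range J, F j :=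
  (sum_subset (range_mono hJ) fun j _ hj => h j (by simpa using hj)).symm

variable {V : Type*} [Module ℂ U] {YV : V → ℤ → V → V} {Y : V → ℤ → U → U} {u v : V} {w : U}

theorem subPowCoeff_eq_zero {n i j : ℤ} (h : ¬(0 ≤ j ∧ i + j = n)) : subPowCoeff n i j = 0 :=
  if_neg h

theorem subPowCoeff_natCast (n : ℤ) (j : ℕ) :
    subPowCoeff n (n - j) j = (-1) ^ j * binom n j := by
  rw [subPowCoeff, if_pos ⟨by positivity, by ring⟩]; rfl

/-- Fixing the exponent of `x₀` leaves one free index `j`, the power of `x₂` in the delta function,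
and truncation of `Y(v, x₂) w` bounds it. The operators are not assumed linear, so their vanishing
at `0` is a hypothesis. -/
theorem eventually_mul_delta012 (hY : ∀ n, Y u n 0 = 0) (hv : ∃ N : ℤ, ∀ n, N ≤ n → Y v n w = 0)
    (e : ℤ × ℤ × ℤ) :
    ∀ᶠ J in atTop,
      (Function.support fun k : ℤ × ℤ × ℤ => delta012 k • (if (e - k).1 = 0 then
        Y u (-(e - k).2.1 - 1) (Y v (-(e - k).2.2 - 1) w) else 0)).Finite ∧
      mulSeries delta012 (fun e : ℤ × ℤ × ℤ => if e.1 = 0 then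
        Y u (-e.2.1 - 1) (Y v (-e.2.2 - 1) w) else 0) e =
      ∑ j ∈ range J, ((-1) ^ j * binom (-e.1 - 1) j) •
        Y u (-e.2.1 - 1 + (-e.1 - 1) - j) (Y v (-e.2.2 - 1 + j) w) := by
  obtain ⟨N, hN⟩ := hv
  obtain ⟨a, b, c⟩ := e
  filter_upwards [eventually_ge_atTop (N + c + 1).toNat] with J hJ
  have := finsum_eq_sum_range_comp (J := J)
    (φ := fun j : ℕ => ((a, -a - 1 - j, j) : ℤ × ℤ × ℤ))
    (F := fun k : ℤ × ℤ × ℤ => delta012 k • (if ((a, b, c) - k).1 = 0 then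
        Y u (-((a, b, c) - k).2.1 - 1) (Y v (-((a, b, c) - k).2.2 - 1) w) else 0))
    (fun i j h => by simpa using h) ?_
  · refine ⟨this.1, this.2.trans (sum_congr rfl fun j _ => ?_)⟩
    simp only [Prod.mk_sub_mk, sub_self, if_true, delta012, subPowCoeff_natCast]
    congr 2
    · ring
    · congr 1; ring
  · rintro ⟨i, j, k⟩ h
    simp only [Prod.mk_sub_mk, delta012] at h
    have h1 := left_ne_zero_of_smul h
    have h2 := right_ne_zero_of_smul h
    by_cases hai : a - i = 0
    · rw [if_pos hai] at h2
      have h3 : 0 ≤ k ∧ j + k = -i - 1 := by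
        by_contra h'; exact h1 (subPowCoeff_eq_zero h')
      have h4 : ¬ N ≤ -(c - k) - 1 := fun h' => h2 (by rw [hN _ h', hY])
      refine ⟨k.toNat, by omega, ?_⟩
      ext <;> simp <;> omega
    · exact (h2 (if_neg hai)).elim

theorem eventually_mul_delta021 (hY : ∀ n, Y v n 0 = 0) (hu : ∃ N : ℤ, ∀ n, N ≤ n → Y u n w = 0)
    (e : ℤ × ℤ × ℤ) :
    ∀ᶠ J in atTop,
      (Function.support fun k : ℤ × ℤ × ℤ => delta021 k • (if (e - k).1 = 0 then
        Y v (-(e - k).2.2 - 1) (Y u (-(e - k).2.1 - 1) w) else 0)).Finite ∧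
      mulSeries delta021 (fun e : ℤ × ℤ × ℤ => if e.1 = 0 then
        Y v (-e.2.2 - 1) (Y u (-e.2.1 - 1) w) else 0) e =
      ∑ j ∈ range J, ((-1) ^ (-e.1 - 1) * ((-1) ^ j * binom (-e.1 - 1) j)) •
        Y v (-e.2.2 - 1 + (-e.1 - 1) - j) (Y u (-e.2.1 - 1 + j) w) := by
  obtain ⟨N, hN⟩ := hu
  obtain ⟨a, b, c⟩ := e
  filter_upwards [eventually_ge_atTop (N + b + 1).toNat] with J hJ
  have := finsum_eq_sum_range_comp (J := J)
    (φ := fun j : ℕ => ((a, j, -a - 1 - j) : ℤ × ℤ × ℤ))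
    (F := fun k : ℤ × ℤ × ℤ => delta021 k • (if ((a, b, c) - k).1 = 0 then
        Y v (-((a, b, c) - k).2.2 - 1) (Y u (-((a, b, c) - k).2.1 - 1) w) else 0))
    (fun i j h => by simpa using h) ?_
  · refine ⟨this.1, this.2.trans (sum_congr rfl fun j _ => ?_)⟩
    simp only [Prod.mk_sub_mk, sub_self, if_true, delta021, subPowCoeff_natCast]
    congr 2
    · ring
    · congr 1; ring
  · rintro ⟨i, k, j⟩ h
    simp only [Prod.mk_sub_mk, delta021] at h
    have h1 := right_ne_zero_of_mul (left_ne_zero_of_smul h)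
    have h2 := right_ne_zero_of_smul h
    by_cases hai : a - i = 0
    · rw [if_pos hai] at h2
      have h3 : 0 ≤ k ∧ j + k = -i - 1 := by
        by_contra h'; exact h1 (subPowCoeff_eq_zero h')
      have h4 : ¬ N ≤ -(b - k) - 1 := fun h' => h2 (by rw [hN _ h', hY])
      refine ⟨k.toNat, by omega, ?_⟩
      ext <;> simp <;> omega
    · exact (h2 (if_neg hai)).elim

theorem eventually_mul_delta210 [Zero V] (hY : ∀ n, Y 0 n w = 0)
    (huv : ∃ N : ℤ, ∀ n, N ≤ n → YV u n v = 0) (e : ℤ × ℤ × ℤ) :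
    ∀ᶠ J in atTop,
      (Function.support fun k : ℤ × ℤ × ℤ => delta210 k • (if (e - k).2.1 = 0 then
        Y (YV u (-(e - k).1 - 1) v) (-(e - k).2.2 - 1) w else 0)).Finite ∧
      mulSeries delta210 (fun e : ℤ × ℤ × ℤ => if e.2.1 = 0 then
        Y (YV u (-e.1 - 1) v) (-e.2.2 - 1) w else 0) e =
      ∑ j ∈ range J, binom (-e.2.1 - 1) j •
        Y (YV u (-e.1 - 1 + j) v) (-e.2.1 - 1 + (-e.2.2 - 1) - j) w := by
  obtain ⟨N, hN⟩ := huv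
  obtain ⟨a, b, c⟩ := e
  filter_upwards [eventually_ge_atTop (N + a + 1).toNat] with J hJ
  have := finsum_eq_sum_range_comp (J := J)
    (φ := fun j : ℕ => ((j, b, -1 - b - j) : ℤ × ℤ × ℤ))
    (F := fun k : ℤ × ℤ × ℤ => delta210 k • (if ((a, b, c) - k).2.1 = 0 then
        Y (YV u (-((a, b, c) - k).1 - 1) v) (-((a, b, c) - k).2.2 - 1) w else 0))
    (fun i j h => by simpa using h) ?_
  · refine ⟨this.1, this.2.trans (sum_congr rfl fun j _ => ?_)⟩
    simp only [Prod.mk_sub_mk, sub_self, if_true, delta210]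
    -- The delta function supplies `(-1) ^ j` times `j + b` choose `j`; upper negation makes this
    -- `-b - 1` choose `j`, which is `m` choose `j` for the mode index `m = -b - 1`.
    rw [← neg_one_pow_mul_binom (-b - 1) j, show (j : ℤ) - (-b - 1) - 1 = j + b by ring,
      ← subPowCoeff_natCast]
    rw [show -(-1 - b - (j : ℤ)) - 1 = j + b by ring, add_sub_cancel_left,
      show -(a - (j : ℤ)) - 1 = -a - 1 + j by ring,
      show -(c - (-1 - b - (j : ℤ))) - 1 = -b - 1 + (-c - 1) - j by ring]
  · rintro ⟨k, i, j⟩ h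
    simp only [Prod.mk_sub_mk, delta210] at h
    have h1 := left_ne_zero_of_smul h
    have h2 := right_ne_zero_of_smul h
    by_cases hai : b - i = 0
    · rw [if_pos hai] at h2
      have h3 : 0 ≤ k ∧ i + k = -j - 1 := by
        by_contra h'; exact h1 (subPowCoeff_eq_zero h')
      have h4 : ¬ N ≤ -(a - k) - 1 := fun h' => h2 (by rw [hN _ h', hY])
      refine ⟨k.toNat, by omega, ?_⟩
      ext <;> simp <;> omega
    · exact (h2 (if_neg hai)).elim

/-- The Jacobi identity in components (the Borcherds identity), stated for all sufficiently long
partial sums. -/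
theorem jacobiOn_iff [Zero V] (hYu : ∀ n, Y u n 0 = 0) (hYv : ∀ n, Y v n 0 = 0)
    (hY : ∀ n, Y 0 n w = 0)
    (hu : ∃ N : ℤ, ∀ n, N ≤ n → Y u n w = 0) (hv : ∃ N : ℤ, ∀ n, N ≤ n → Y v n w = 0)
    (huv : ∃ N : ℤ, ∀ n, N ≤ n → YV u n v = 0) :
    JacobiOn YV Y u v w ↔ ∀ l m n : ℤ, ∀ᶠ J in atTop,
      ∑ j ∈ range J, ((-1) ^ j * binom l j) • Y u (m + l - j) (Y v (n + j) w) -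
        ∑ j ∈ range J, ((-1) ^ l * ((-1) ^ j * binom l j)) • Y v (n + l - j) (Y u (m + j) w) =
      ∑ j ∈ range J, binom m j • Y (YV u (l + j) v) (m + n - j) w := by
  constructor
  · rintro ⟨-, -, -, h⟩ l m n
    -- The coefficient of `x ^ (-n - 1)` carries the mode of index `n`, in each of the three
    -- variables.
    have he := congrFun h (-l - 1, -m - 1, -n - 1)
    filter_upwards [eventually_mul_delta012 hYu hv (-l - 1, -m - 1, -n - 1),
      eventually_mul_delta021 hYv hu (-l - 1, -m - 1, -n - 1),
      eventually_mul_delta210 hY huv (-l - 1, -m - 1, -n - 1)] with J h1 h2 h3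
    rw [Pi.sub_apply, h1.2, h2.2, h3.2] at he
    simpa only [neg_sub, sub_neg_eq_add, add_sub_cancel_left] using he
  · intro h
    refine ⟨fun e => ?_, fun e => ?_, fun e => ?_, funext fun e => ?_⟩
    · obtain ⟨J, hJ⟩ := (eventually_mul_delta012 hYu hv e).exists
      exact hJ.1
    · obtain ⟨J, hJ⟩ := (eventually_mul_delta021 hYv hu e).exists
      exact hJ.1
    · obtain ⟨J, hJ⟩ := (eventually_mul_delta210 hY huv e).exists
      exact hJ.1
    · obtain ⟨J, h0, h1, h2, h3⟩ := ((h (-e.1 - 1) (-e.2.1 - 1) (-e.2.2 - 1)).and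
        ((eventually_mul_delta012 hYu hv e).and ((eventually_mul_delta021 hYv hu e).and
          (eventually_mul_delta210 hY huv e)))).exists
      rw [Pi.sub_apply, h1.2, h2.2, h3.2]
      exact h0

end Jacobi

/-! ### Linear maps on Laurent series that ignore high order terms. -/

section Laurent

theorem laurent_smul_mul (r : ℂ) (f g : LaurentSeries ℂ) : r • f * g = r • (f * g) := by
  rw [← HahnSeries.C_mul_eq_smul, ← HahnSeries.C_mul_eq_smul, mul_assoc]

theorem laurent_mul_smul (r : ℂ) (f g : LaurentSeries ℂ) : f * r • g = r • (f * g) := by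
  rw [mul_comm, laurent_smul_mul, mul_comm]

theorem coeff_mul_eq_zero {f g : LaurentSeries ℂ} {M N n : ℤ} (hf : ∀ n < M, f.coeff n = 0)
    (hg : ∀ n < N, g.coeff n = 0) (hn : n < M + N) : (f * g).coeff n = 0 := by
  rw [HahnSeries.coeff_mul]
  refine sum_eq_zero fun p hp => ?_
  have hp' := (Finset.mem_antidiagonal.mp hp).2.2
  rcases lt_or_ge p.1 M with h | h
  · rw [hf _ h, zero_mul]
  · rw [hg _ (by omega), mul_zero]

variable {U : Type*} [AddCommGroup U]

/-- A map on Laurent series that vanishes on all series of sufficiently high order. -/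
def VanishesAtHighOrder (Φ : LaurentSeries ℂ → U) : Prop :=
  ∃ N : ℤ, ∀ f : LaurentSeries ℂ, (∀ n < N, f.coeff n = 0) → Φ f = 0

namespace VanishesAtHighOrder

theorem sub {Φ Ψ : LaurentSeries ℂ → U} (hΦ : VanishesAtHighOrder Φ)
    (hΨ : VanishesAtHighOrder Ψ) : VanishesAtHighOrder fun f => Φ f - Ψ f := by
  obtain ⟨N, hN⟩ := hΦ
  obtain ⟨M, hM⟩ := hΨ
  exact ⟨max N M, fun f hf => by
    beta_reduce
    rw [hN f fun n hn => hf n (hn.trans_le (le_max_left _ _)),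
      hM f fun n hn => hf n (hn.trans_le (le_max_right _ _)), sub_zero]⟩

theorem sum {ι : Type*} (s : Finset ι) {Φ : ι → LaurentSeries ℂ → U}
    (hΦ : ∀ i ∈ s, VanishesAtHighOrder (Φ i)) : VanishesAtHighOrder fun f => ∑ i ∈ s, Φ i f := by
  classical
  induction s using Finset.induction_on with
  | empty => exact ⟨0, fun f _ => by simp⟩
  | insert i s hi ih =>
    obtain ⟨N, hN⟩ := hΦ i (mem_insert_self i s)
    obtain ⟨M, hM⟩ := ih fun j hj => hΦ j (mem_insert_of_mem hj)
    refine ⟨max N M, fun f hf => ?_⟩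
    have h1 := hN f fun n hn => hf n (hn.trans_le (le_max_left _ _))
    have h2 := hM f fun n hn => hf n (hn.trans_le (le_max_right _ _))
    beta_reduce
    rw [sum_insert hi, h1, zero_add]
    exact h2

theorem const_smul [Module ℂ U] (c : ℂ) {Φ : LaurentSeries ℂ → U} (hΦ : VanishesAtHighOrder Φ) :
    VanishesAtHighOrder fun f => c • Φ f := by
  obtain ⟨N, hN⟩ := hΦ
  exact ⟨N, fun f hf => by beta_reduce; rw [hN f hf, smul_zero]⟩

theorem map {U' : Type*} [AddCommGroup U'] [Module ℂ U] [Module ℂ U'] (A : U →ₗ[ℂ] U')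
    {Φ : LaurentSeries ℂ → U} (hΦ : VanishesAtHighOrder Φ) :
    VanishesAtHighOrder fun f => A (Φ f) := by
  obtain ⟨N, hN⟩ := hΦ
  exact ⟨N, fun f hf => by beta_reduce; rw [hN f hf, map_zero]⟩

theorem comp_mul_left {Φ : LaurentSeries ℂ → U} (hΦ : VanishesAtHighOrder Φ)
    (g : LaurentSeries ℂ) : VanishesAtHighOrder fun f => Φ (g * f) := by
  obtain ⟨N, hN⟩ := hΦ
  exact ⟨N - g.order, fun f hf => hN _ fun n hn => coeff_mul_eq_zero
    (fun n hn => HahnSeries.coeff_eq_zero_of_lt_order hn) hf (by omega)⟩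

theorem comp_mul_right {Φ : LaurentSeries ℂ → U} (hΦ : VanishesAtHighOrder Φ)
    (g : LaurentSeries ℂ) : VanishesAtHighOrder fun f => Φ (f * g) := by
  simpa only [mul_comm] using hΦ.comp_mul_left g

theorem comp_hasseDeriv {Φ : LaurentSeries ℂ → U} (hΦ : VanishesAtHighOrder Φ) (j : ℕ) :
    VanishesAtHighOrder fun f => Φ (LaurentSeries.hasseDeriv ℂ j f) := by
  obtain ⟨N, hN⟩ := hΦ
  exact ⟨N + j, fun f hf => hN _ fun n hn => by
    rw [LaurentSeries.hasseDeriv_coeff, hf _ (by omega), smul_zero]⟩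

end VanishesAtHighOrder

/-- A linear map on Laurent series that ignores terms of high order and kills the monomials of
order at least `M` kills every Laurent series of order at least `M`. -/
theorem apply_eq_zero_of_single [Module ℂ U] {Φ : LaurentSeries ℂ →ₗ[ℂ] U} {M : ℤ}
    (hΦ : VanishesAtHighOrder Φ)
    (hs : ∀ m, M ≤ m → Φ (HahnSeries.single m 1) = 0) {f : LaurentSeries ℂ}
    (hf : ∀ n < M, f.coeff n = 0) : Φ f = 0 := by
  obtain ⟨N, hΦ⟩ := hΦ
  -- After subtracting the finitely many terms of order in `[M, N)`, what remains has order at least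
  -- `N`.
  have h : Φ (f - ∑ n ∈ Ico M N, f.coeff n • HahnSeries.single n (1 : ℂ)) = 0 := by
    refine hΦ _ fun k hk => ?_
    rw [HahnSeries.coeff_sub, HahnSeries.coeff_sum]
    simp only [HahnSeries.coeff_smul, HahnSeries.coeff_single, smul_eq_mul, mul_ite, mul_one,
      mul_zero, sum_ite_eq, mem_Ico]
    split_ifs with h
    · simp
    · rw [hf k (by omega), sub_zero]
  rw [map_sub, map_sum, sub_eq_zero] at h
  rw [h]
  exact sum_eq_zero fun n hn => by rw [map_smul, hs n (mem_Ico.mp hn).1, smul_zero]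

end Laurent

/-! ### Expansion of `(t + y) ^ a` at `t = 0`. -/

section ShiftPow

theorem iotaPlus_mul (f g : RatFunc ℂ) : iotaPlus (f * g) = iotaPlus f * iotaPlus g :=
  map_mul (algebraMap (RatFunc ℂ) (LaurentSeries ℂ)) f g

theorem iotaPlus_one : iotaPlus 1 = 1 := map_one (algebraMap (RatFunc ℂ) (LaurentSeries ℂ))

theorem iotaPlus_zpow (f : RatFunc ℂ) (n : ℤ) : iotaPlus (f ^ n) = iotaPlus f ^ n :=
  map_zpow₀ (algebraMap (RatFunc ℂ) (LaurentSeries ℂ)) f n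

theorem iotaPlus_X : iotaPlus RatFunc.X = HahnSeries.single 1 1 := RatFunc.coe_X

theorem iotaPlus_X_zpow (n : ℤ) : iotaPlus (RatFunc.X ^ n) = HahnSeries.single n 1 := by
  rw [iotaPlus_zpow, iotaPlus_X]
  rw [← RatFunc.single_zpow]

theorem X_add_C_ne_zero (y : ℂ) : (RatFunc.X + RatFunc.C y : RatFunc ℂ) ≠ 0 := fun h =>
  transcendental_X_add y (h ▸ isAlgebraic_zero)

/-- The power series of coefficients of `(y + t) ^ a`. -/
def binomialExpansion (y : ℂ) (a : ℤ) : PowerSeries ℂ :=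
  PowerSeries.mk fun n => binom a n * y ^ (a - n)

theorem X_add_C_mul_binomialExpansion {y : ℂ} (hy : y ≠ 0) (a : ℤ) :
    (PowerSeries.X + PowerSeries.C y) * binomialExpansion y a = binomialExpansion y (a + 1) := by
  ext n
  cases n with
  | zero =>
    simp [binomialExpansion, add_mul, zpow_add₀ hy, mul_comm]
  | succ n =>
    simp only [binomialExpansion, add_mul, map_add, PowerSeries.coeff_succ_X_mul,
      PowerSeries.coeff_mk, PowerSeries.coeff_C_mul, binom_succ_succ]
    rw [show a + 1 - ((n + 1 : ℕ) : ℤ) = a - n by push_cast; ring,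
      show a - (n : ℤ) = a - ((n + 1 : ℕ) : ℤ) + 1 by push_cast; ring, zpow_add_one₀ hy]
    ring

theorem iotaPlus_X_add_C_zpow {y : ℂ} (hy : y ≠ 0) (a : ℤ) :
    iotaPlus ((RatFunc.X + RatFunc.C y) ^ a) =
      HahnSeries.ofPowerSeries ℤ ℂ (binomialExpansion y a) := by
  have hX : iotaPlus (RatFunc.X + RatFunc.C y) =
      HahnSeries.ofPowerSeries ℤ ℂ (PowerSeries.X + PowerSeries.C y) := by
    rw [map_add, map_add, iotaPlus_X, HahnSeries.ofPowerSeries_X, HahnSeries.ofPowerSeries_C]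
    congr 1
    rw [← mul_one (RatFunc.C y), ← RatFunc.smul_eq_C_mul, map_smul, iotaPlus_one,
      ← HahnSeries.C_mul_eq_smul, mul_one]
  have hne : iotaPlus (RatFunc.X + RatFunc.C y) ≠ 0 := fun h =>
    X_add_C_ne_zero y ((map_eq_zero (algebraMap (RatFunc ℂ) (LaurentSeries ℂ))).mp h)
  have step (a : ℤ) : iotaPlus (RatFunc.X + RatFunc.C y) *
      HahnSeries.ofPowerSeries ℤ ℂ (binomialExpansion y a) =
        HahnSeries.ofPowerSeries ℤ ℂ (binomialExpansion y (a + 1)) := by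
    rw [hX, ← map_mul, X_add_C_mul_binomialExpansion hy]
  rw [iotaPlus_zpow]
  induction a using Int.induction_on with
  | zero =>
    have : binomialExpansion y 0 = 1 := by
      ext n
      cases n with
      | zero => simp [binomialExpansion]
      | succ n => simp [binomialExpansion, binom_zero_succ, PowerSeries.coeff_one]
    rw [this]; simp
  | succ i hi => rw [zpow_add_one₀ hne, hi, mul_comm, step]
  | pred i hi =>
    apply mul_left_cancel₀ hne
    rw [step, sub_add_cancel, ← hi, mul_comm, ← zpow_add_one₀ hne, sub_add_cancel]

theorem coeff_iotaPlus_X_add_C_zpow {y : ℂ} (hy : y ≠ 0) (a n : ℤ) :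
    (iotaPlus ((RatFunc.X + RatFunc.C y) ^ a)).coeff n =
      if 0 ≤ n then binom a n.toNat * y ^ (a - n) else 0 := by
  rw [iotaPlus_X_add_C_zpow hy]
  split_ifs with h
  · lift n to ℕ using h
    simp [binomialExpansion]
  · rw [HahnSeries.ofPowerSeries_apply]
    apply HahnSeries.embDomain_of_notMem_range
    rintro ⟨k, rfl⟩
    simp at h

/-- On coefficients this is `binom_mul_binom_sub`. The case `y = 0` is separate, since there the
expansion is a single monomial with a possibly negative exponent. -/
theorem hasseDeriv_iotaPlus_X_add_C_zpow (y : ℂ) (a : ℤ) (k : ℕ) :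
    LaurentSeries.hasseDeriv ℂ k (iotaPlus ((RatFunc.X + RatFunc.C y) ^ a)) =
      binom a k • iotaPlus ((RatFunc.X + RatFunc.C y) ^ (a - k)) := by
  by_cases hy : y = 0
  · subst hy
    rw [map_zero, add_zero, iotaPlus_X_zpow, iotaPlus_X_zpow, LaurentSeries.hasseDeriv_single]
    ext n
    simp [HahnSeries.coeff_single, binom]
  · ext n
    rw [LaurentSeries.hasseDeriv_coeff, HahnSeries.coeff_smul, coeff_iotaPlus_X_add_C_zpow hy,
      coeff_iotaPlus_X_add_C_zpow hy]
    by_cases h : 0 ≤ n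
    · lift n to ℕ using h
      have h1 : (0 : ℤ) ≤ n + k := by positivity
      have h2 : ((n : ℤ) + k).toNat = k + n := by omega
      rw [if_pos h1, if_pos (by positivity), h2, smul_eq_mul, Int.toNat_natCast, ← mul_assoc,
        binom_mul_binom_sub, zsmul_eq_mul, sub_sub, ← mul_assoc]
      congr 2
      · rw [← Nat.cast_add, Ring.choose_natCast, add_comm n k]; simp
      · ring
    · by_cases h1 : (0 : ℤ) ≤ n + k
      -- For `-k ≤ n < 0` the differentiated series does have a term in degree `n + k`, but the
      -- factor `n + k` choose `k` kills it.
      · have : Ring.choose (n + k) k = 0 := by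
          lift n + k to ℕ using h1 with p hp
          rw [Ring.choose_natCast, Nat.choose_eq_zero_of_lt (by omega), Nat.cast_zero]
        rw [this, if_neg h, zero_smul, smul_zero]
      · rw [if_neg h1, if_neg h, smul_zero, smul_zero]

variable {U : Type*} [AddCommGroup U] [Module ℂ U]

/-- Expansion of `(y + t) ^ p` under a linear map that ignores terms of high order. -/
theorem eventually_apply_mul_X_add_C_zpow {Φ : LaurentSeries ℂ →ₗ[ℂ] U}
    (hΦ : VanishesAtHighOrder Φ)
    (f : LaurentSeries ℂ) :
    ∀ᶠ K in atTop, ∀ y : ℂ, y ≠ 0 → ∀ p : ℤ, Φ (f * iotaPlus ((RatFunc.X + RatFunc.C y) ^ p)) =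
      ∑ k ∈ range K, (binom p k * y ^ (p - k)) • Φ (f * HahnSeries.single (k : ℤ) 1) := by
  obtain ⟨N, hΦ⟩ := hΦ
  -- The remainder of the expansion has order at least `K`, whatever `y` and `p` are, so a single
  -- `K` serves for all of them.
  filter_upwards [eventually_ge_atTop (N - f.order).toNat] with K hK y hy p
  rw [← sub_eq_zero]
  simp only [← map_smul]
  rw [← map_sum, ← map_sub]
  simp only [← laurent_mul_smul]
  rw [← mul_sum, ← mul_sub]
  refine hΦ _ fun n hn => coeff_mul_eq_zero (M := f.order) (N := K)
    (fun n hn => HahnSeries.coeff_eq_zero_of_lt_order hn) (fun n hn => ?_) (by omega)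
  rw [HahnSeries.coeff_sub, HahnSeries.coeff_sum, coeff_iotaPlus_X_add_C_zpow hy]
  simp only [HahnSeries.coeff_smul, HahnSeries.coeff_single, smul_eq_mul, mul_ite, mul_one,
    mul_zero]
  split_ifs with h
  · lift n to ℕ using h
    simp only [Nat.cast_inj, sum_ite_eq, mem_range, Int.toNat_natCast]
    rw [if_pos (by omega), sub_self]
  · rw [sum_eq_zero, sub_zero]
    intro k _
    rw [if_neg (by omega)]

end ShiftPow

/-! ### The Jacobi identity on a module, weighted by Laurent series. -/

section TauW

variable {V W : Type*} [AddCommGroup V] [Module ℂ V] [AddCommGroup W] [Module ℂ W]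

@[simp] theorem mode_zero (Y : V →ₗ[ℂ] VertexOperator ℂ W) (n : ℤ) : mode Y 0 n = 0 := by
  simp only [mode, map_zero, Pi.zero_apply]

theorem mode_add (Y : V →ₗ[ℂ] VertexOperator ℂ W) (u v : V) (n : ℤ) :
    mode Y (u + v) n = mode Y u n + mode Y v n := by
  simp only [mode, map_add, Pi.add_apply]

theorem mode_smul (Y : V →ₗ[ℂ] VertexOperator ℂ W) (r : ℂ) (v : V) (n : ℤ) :
    mode Y (r • v) n = r • mode Y v n := by
  simp only [mode, map_smul, Pi.smul_apply]

theorem tauW_tmul_apply (Y : V →ₗ[ℂ] VertexOperator ℂ W) (v : V) (f : LaurentSeries ℂ) (w : W) :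
    tauW Y (v ⊗ₜ f) w = ∑ᶠ n : ℤ, f.coeff n • mode Y v n w := rfl

theorem exists_mode_eq_zero (Y : V →ₗ[ℂ] VertexOperator ℂ W) (v : V) (w : W) :
    ∃ N : ℤ, ∀ n, N ≤ n → mode Y v n w = 0 :=
  ⟨-((HahnModule.of ℂ).symm (Y v w)).order, fun n hn =>
    VertexOperator.ncoeff_eq_zero_of_lt_order (Y v) n w (by omega)⟩

theorem tauW_tmul_eq_zero {Y : V →ₗ[ℂ] VertexOperator ℂ W} {v : V} {w : W} {N : ℤ}
    (h : ∀ n, N ≤ n → mode Y v n w = 0) {f : LaurentSeries ℂ} (hf : ∀ n < N, f.coeff n = 0) :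
    tauW Y (v ⊗ₜ f) w = 0 := by
  rw [tauW_tmul_apply]
  refine finsum_eq_zero_of_forall_eq_zero fun n => ?_
  rcases lt_or_ge n N with hn | hn
  · rw [hf n hn, zero_smul]
  · rw [h n hn, smul_zero]

theorem vanishesAtHighOrder_tauW (Y : V →ₗ[ℂ] VertexOperator ℂ W) (v : V) (w : W) :
    VanishesAtHighOrder fun f => tauW Y (v ⊗ₜ f) w := by
  obtain ⟨N, hN⟩ := exists_mode_eq_zero Y v w
  exact ⟨N, fun f hf => tauW_tmul_eq_zero hN hf⟩

theorem tauW_tmul_single (Y : V →ₗ[ℂ] VertexOperator ℂ W) (v : V) (n : ℤ) :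
    tauW Y (v ⊗ₜ HahnSeries.single n 1) = mode Y v n := by
  ext w
  rw [tauW_tmul_apply, finsum_eq_single _ n]
  · simp
  · intro m hm
    rw [HahnSeries.coeff_single_of_ne hm, zero_smul]

/-- The Jacobi identity for `τ_W`, paired with `f(t₁) g(t₂) (t₁ - t₂) ^ l`. -/
theorem eventually_tauW_jacobi {YV : V →ₗ[ℂ] VertexOperator ℂ V}
    {Y : V →ₗ[ℂ] VertexOperator ℂ W} {u v : V} {w : W}
    (hJ : JacobiOn (fun a n b => mode YV a n b) (fun a n b => mode Y a n b) u v w)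
    (f g : LaurentSeries ℂ) (l : ℤ) :
    ∀ᶠ J in atTop,
      ∑ j ∈ range J, ((-1) ^ j * binom l j) •
          tauW Y (u ⊗ₜ (HahnSeries.single (l - j) 1 * f))
            (tauW Y (v ⊗ₜ (HahnSeries.single (j : ℤ) 1 * g)) w) -
        ∑ j ∈ range J, ((-1) ^ l * ((-1) ^ j * binom l j)) •
          tauW Y (v ⊗ₜ (HahnSeries.single (l - j) 1 * g))
            (tauW Y (u ⊗ₜ (HahnSeries.single (j : ℤ) 1 * f)) w) =
      ∑ j ∈ range J,
        tauW Y (mode YV u (l + j) v ⊗ₜ (LaurentSeries.hasseDeriv ℂ j f * g)) w := by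
  have hJ' := (jacobiOn_iff (by simp) (by simp) (by simp) (exists_mode_eq_zero Y u w)
    (exists_mode_eq_zero Y v w) (exists_mode_eq_zero YV u v)).mp hJ
  obtain ⟨Nu, hu⟩ := exists_mode_eq_zero Y u w
  obtain ⟨Nv, hv⟩ := exists_mode_eq_zero Y v w
  obtain ⟨Nuv, huv⟩ := exists_mode_eq_zero YV u v
  have hf := fun n (hn : n < f.order) => HahnSeries.coeff_eq_zero_of_lt_order hn
  have hg := fun n (hn : n < g.order) => HahnSeries.coeff_eq_zero_of_lt_order hn
  generalize f.order = Mf at hf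
  generalize g.order = Mg at hg
  -- Beyond `J₀` every term vanishes for all monomials of order at least `Mf` and `Mg`; the bound
  -- does not depend on the monomials.
  let J₀ : ℕ := (max (Nv - Mg) (max (Nu - Mf) (Nuv - l))).toNat
  filter_upwards [eventually_ge_atTop J₀] with J hJ₀
  -- The defect of the identity is bilinear in `f` and `g`. It vanishes on monomials by the
  -- component identity, and it ignores high order terms in each variable separately, so it vanishes
  -- on `(f, g)`.
  let B : LaurentSeries ℂ →ₗ[ℂ] LaurentSeries ℂ →ₗ[ℂ] W := LinearMap.mk₂ ℂ
    (fun f g => ∑ j ∈ range J, ((-1) ^ j * binom l j) •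
          tauW Y (u ⊗ₜ (HahnSeries.single (l - j) 1 * f))
            (tauW Y (v ⊗ₜ (HahnSeries.single (j : ℤ) 1 * g)) w) -
        ∑ j ∈ range J, ((-1) ^ l * ((-1) ^ j * binom l j)) •
          tauW Y (v ⊗ₜ (HahnSeries.single (l - j) 1 * g))
            (tauW Y (u ⊗ₜ (HahnSeries.single (j : ℤ) 1 * f)) w) -
      ∑ j ∈ range J,
        tauW Y (mode YV u (l + j) v ⊗ₜ (LaurentSeries.hasseDeriv ℂ j f * g)) w)
    (fun f f' g => by
      simp only [mul_add, add_mul, TensorProduct.tmul_add, map_add, LinearMap.add_apply, smul_add,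
        sum_add_distrib]
      abel)
    (fun r f g => by
      simp only [laurent_mul_smul, laurent_smul_mul, TensorProduct.tmul_smul, map_smul,
        LinearMap.smul_apply, smul_sub, smul_sum, smul_comm r])
    (fun f g g' => by
      simp only [mul_add, TensorProduct.tmul_add, map_add, LinearMap.add_apply, smul_add,
        sum_add_distrib]
      abel)
    (fun r f g => by
      simp only [laurent_mul_smul, TensorProduct.tmul_smul, map_smul,
        LinearMap.smul_apply, smul_sub, smul_sum, smul_comm r])
  suffices h : B f g = 0 from sub_eq_zero.mp h
  have hB (f g : LaurentSeries ℂ) : B f g = ∑ j ∈ range J, ((-1) ^ j * binom l j) •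
          tauW Y (u ⊗ₜ (HahnSeries.single (l - j) 1 * f))
            (tauW Y (v ⊗ₜ (HahnSeries.single (j : ℤ) 1 * g)) w) -
        ∑ j ∈ range J, ((-1) ^ l * ((-1) ^ j * binom l j)) •
          tauW Y (v ⊗ₜ (HahnSeries.single (l - j) 1 * g))
            (tauW Y (u ⊗ₜ (HahnSeries.single (j : ℤ) 1 * f)) w) -
      ∑ j ∈ range J,
        tauW Y (mode YV u (l + j) v ⊗ₜ (LaurentSeries.hasseDeriv ℂ j f * g)) w := rfl
  have hmono (m n : ℤ) (hm : Mf ≤ m) (hn : Mg ≤ n) :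
      B (HahnSeries.single m 1) (HahnSeries.single n 1) = 0 := by
    obtain ⟨J₁, hJ₁, hle⟩ := ((hJ' l m n).and (eventually_ge_atTop J)).exists
    rw [sum_range_eq_of_eq_zero hle, sum_range_eq_of_eq_zero hle,
      sum_range_eq_of_eq_zero hle] at hJ₁
    · rw [hB, sub_eq_zero]
      simp only [HahnSeries.single_mul_single, mul_one, LaurentSeries.hasseDeriv_single,
        tauW_tmul_single]
      convert hJ₁ using 2
      · congr 1
        ext j
        rw [add_comm n, show m + l - (j : ℤ) = l - j + m by ring]
      · congr 1
        ext j
        rw [add_comm m, show n + l - (j : ℤ) = l - j + n by ring]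
      · rename_i j _
        have h : HahnSeries.single (m - (j : ℤ) + n) (Ring.choose m j • (1 : ℂ)) =
            binom m j • HahnSeries.single (m + n - (j : ℤ)) 1 := by
          rw [show m - (j : ℤ) + n = m + n - j by ring]
          ext; simp [HahnSeries.coeff_single, binom]
        rw [h, TensorProduct.tmul_smul, map_smul, tauW_tmul_single, LinearMap.smul_apply]
    all_goals intro j hj; simp only [J₀] at hJ₀
    · rw [huv (l + j) (by omega)]; simp
    · rw [hu (m + j) (by omega)]; simp
    · rw [hv (n + j) (by omega)]; simp
  have hvan := vanishesAtHighOrder_tauW Y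
  have hfirst (n : ℤ) (hn : Mg ≤ n) : B f (HahnSeries.single n 1) = 0 := by
    refine apply_eq_zero_of_single (Φ := B.flip (HahnSeries.single n 1)) ?_
      (fun m hm => hmono m n hm hn) hf
    change VanishesAtHighOrder fun f => B f (HahnSeries.single n 1)
    simp only [hB]
    refine ((VanishesAtHighOrder.sum _ fun j _ => ?_).sub
      (VanishesAtHighOrder.sum _ fun j _ => ?_)).sub (VanishesAtHighOrder.sum _ fun j _ => ?_)
    · exact ((hvan _ _).comp_mul_left _).const_smul _
    · exact (((hvan _ _).comp_mul_left _).map _).const_smul _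
    · exact ((hvan _ _).comp_mul_right _).comp_hasseDeriv j
  refine apply_eq_zero_of_single ?_ hfirst hg
  change VanishesAtHighOrder fun g => B f g
  simp only [hB]
  refine ((VanishesAtHighOrder.sum _ fun j _ => ?_).sub
    (VanishesAtHighOrder.sum _ fun j _ => ?_)).sub (VanishesAtHighOrder.sum _ fun j _ => ?_)
  · exact (((hvan _ _).comp_mul_left _).map _).const_smul _
  · exact ((hvan _ _).comp_mul_left _).const_smul _
  · exact (hvan _ _).comp_mul_left _

end TauW

/-! ### Sums over triples with fixed total. -/

section TripleSum

variable {U : Type*} [AddCommGroup U]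

/-- The sum of `F i b c` over all `i + b + c = p`. -/
def tripleSum (p : ℕ) (F : ℕ → ℕ → ℕ → U) : U :=
  ∑ x ∈ antidiagonal p, ∑ y ∈ antidiagonal x.2, F x.1 y.1 y.2

theorem tripleSum_congr {p : ℕ} {F G : ℕ → ℕ → ℕ → U}
    (h : ∀ i b c, i + b + c = p → F i b c = G i b c) : tripleSum p F = tripleSum p G := by
  refine sum_congr rfl fun x hx => sum_congr rfl fun y hy => h _ _ _ ?_
  rw [HasAntidiagonal.mem_antidiagonal] at hx hy
  omega

theorem tripleSum_add (p : ℕ) (F G : ℕ → ℕ → ℕ → U) :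
    tripleSum p (fun i b c => F i b c + G i b c) = tripleSum p F + tripleSum p G := by
  simp only [tripleSum, sum_add_distrib]

theorem tripleSum_succ_left {p : ℕ} {F : ℕ → ℕ → ℕ → U} (h : ∀ b c, F 0 b c = 0) :
    tripleSum (p + 1) F = tripleSum p fun i b c => F (i + 1) b c := by
  simp only [tripleSum, Finset.Nat.sum_antidiagonal_succ, h, sum_const_zero, zero_add]

theorem tripleSum_succ_middle {p : ℕ} {F : ℕ → ℕ → ℕ → U} (h : ∀ i c, F i 0 c = 0) :
    tripleSum (p + 1) F = tripleSum p fun i b c => F i (b + 1) c := by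
  rw [tripleSum, Finset.Nat.sum_antidiagonal_succ']
  simp only [tripleSum, Finset.Nat.sum_antidiagonal_succ, Finset.Nat.antidiagonal_zero,
    sum_singleton, h, zero_add]

theorem tripleSum_succ_right {p : ℕ} {F : ℕ → ℕ → ℕ → U} (h : ∀ i b, F i b 0 = 0) :
    tripleSum (p + 1) F = tripleSum p fun i b c => F i b (c + 1) := by
  simp only [tripleSum, Finset.Nat.sum_antidiagonal_succ',
    Finset.Nat.antidiagonal_zero, sum_singleton, h, zero_add]

/-- The simplex `i + b + c < P` contains the box on which `F` can be nonzero. -/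
theorem sum_range_tripleSum {I B C P : ℕ} (hP : I + B + C ≤ P) {F : ℕ → ℕ → ℕ → U}
    (hI : ∀ i b c, I ≤ i → F i b c = 0) (hB : ∀ i b c, B ≤ b → F i b c = 0)
    (hC : ∀ i b c, C ≤ c → F i b c = 0) :
    ∑ p ∈ range P, tripleSum p F = ∑ i ∈ range I, ∑ b ∈ range B, ∑ c ∈ range C, F i b c := by
  have flip (n : ℕ) (H : ℕ → ℕ → U) :
      ∑ p ∈ range n, ∑ x ∈ antidiagonal p, H x.1 x.2 =
        ∑ a ∈ range n, ∑ r ∈ range (n - a), H a r := by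
    simp only [Finset.Nat.sum_antidiagonal_eq_sum_range_succ]
    exact sum_range_diag_flip n H
  unfold tripleSum
  rw [flip P fun i r => ∑ y ∈ antidiagonal r, F i y.1 y.2]
  simp only [flip]
  rw [sum_range_eq_of_eq_zero (show I ≤ P by omega) fun i hi => by simp [hI i _ _ hi]]
  refine sum_congr rfl fun i hi => ?_
  rw [mem_range] at hi
  rw [sum_range_eq_of_eq_zero (show B ≤ P - i by omega) fun b hb => by simp [hB i b _ hb]]
  refine sum_congr rfl fun b hb => ?_
  rw [mem_range] at hb
  exact sum_range_eq_of_eq_zero (by omega) fun c hc => hC i b c hc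

end TripleSum

/-! ### The action of `L(1)` on `V` and conjugation of vertex operators. -/

section Sl2

variable {At : Type*} [AddCommGroup At] {A : AddSubgroup At}
  {V : Type*} [AddCommGroup V] [Module ℂ V]

namespace StronglyGradedVertexAlgebra

variable (VA : StronglyGradedVertexAlgebra A V)

/-- The component identity with `l = 0` is the commutator formula for `ω_a`; `a = 0, 1, 2` give the
brackets with `L(-1)`, `L(0)`, `L(1)`. -/
theorem IsConformal.isMobius {VA : StronglyGradedVertexAlgebra A V} {ω : V} {c : ℂ}
    (h : VA.IsConformal ω c) : VA.IsMobius := by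
  obtain ⟨-, -, hn, h0, hp, -⟩ := h
  have comm (a : ℕ) (v : V) (n : ℤ) :
      ⁅mode VA.Y ω a, mode VA.Y v n⁆ =
        ∑ j ∈ range (a + 1), binom a j • mode VA.Y (mode VA.Y ω j v) (a + n - j) := by
    ext w
    have hJ := (jacobiOn_iff (by simp) (by simp) (by simp) (exists_mode_eq_zero VA.Y ω w)
      (exists_mode_eq_zero VA.Y v w) (exists_mode_eq_zero VA.Y ω v)).mp (VA.jacobi ω v w) 0 a n
    obtain ⟨J, hJ, hle⟩ := (hJ.and (eventually_ge_atTop (a + 1))).exists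
    have e (f : ℕ → V) : ∑ j ∈ range J, ((-1) ^ j * binom 0 j) • f j = f 0 := by
      rw [sum_eq_single_of_mem 0 (mem_range.mpr (by omega))]
      · simp
      · intro j _ hj
        obtain ⟨k, rfl⟩ := Nat.exists_eq_add_one_of_ne_zero hj
        simp [binom_zero_succ]
    simp only [zpow_zero, one_mul] at hJ
    rw [e, e, sum_range_eq_of_eq_zero hle fun j hj => by
      rw [binom_natCast, Nat.choose_eq_zero_of_lt (by omega), Nat.cast_zero, zero_smul]] at hJ
    simp only [Nat.cast_zero, add_zero, sub_zero, zero_add] at hJ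
    rw [Ring.lie_def, LinearMap.sub_apply, Module.End.mul_apply, Module.End.mul_apply, hJ]
    simp
  intro v n
  rw [hn, h0, hp]
  refine ⟨?_, ?_, ?_⟩
  · have := comm 0 v n
    simpa using this
  · have := comm 1 v n
    simp only [sum_range_succ, binom_natCast] at this
    simp only [Nat.cast_one] at this
    rw [this]
    simp [add_comm]
  · have := comm 2 v n
    simp only [sum_range_succ, binom_natCast] at this
    simp only [Nat.cast_ofNat] at this
    rw [this]
    simp only [range_zero, sum_empty, zero_add, Nat.choose_zero_right, Nat.cast_one, one_smul,
      Nat.cast_zero, sub_zero, Nat.choose_one_right, Nat.cast_ofNat, Nat.choose_self]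
    rw [show (2 : ℤ) + n - 1 = n + 1 by ring, show (2 : ℤ) + n - 2 = n by ring, add_comm 2 n]
    abel

/-- The divided power `L(1) ^ i / i!`. -/
def divL1 (i : ℕ) : Module.End ℂ V := (i.factorial : ℂ)⁻¹ • VA.L.pos ^ i

theorem divL1_zero_apply (v : V) : VA.divL1 0 v = v := by simp [divL1]

theorem L1_divL1 (i : ℕ) (v : V) :
    VA.L.pos (VA.divL1 i v) = ((i : ℂ) + 1) • VA.divL1 (i + 1) v := by
  have h : (i : ℂ) + 1 ≠ 0 := Nat.cast_add_one_ne_zero i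
  simp only [divL1, LinearMap.smul_apply, map_smul, pow_succ', Module.End.mul_apply, smul_smul,
    Nat.factorial_succ, Nat.cast_mul, Nat.cast_add, Nat.cast_one, mul_inv]
  rw [mul_inv_cancel_left₀ h]

theorem exists_divL1_eq_zero (v : V) : ∃ N : ℕ, ∀ i, N ≤ i → VA.divL1 i v = 0 := by
  obtain ⟨N, hN⟩ := VA.L1_nilpotent v
  exact ⟨N, fun i hi => by simp [divL1, hN i hi]⟩

theorem L1_mem_wt {h : ℤ} {v : V} (hv : v ∈ VA.wt h) : VA.L.pos v ∈ VA.wt (h - 1) := by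
  refine VA.mem_wt_of_L0 _ _ ?_
  have h := congrArg (fun T : Module.End ℂ V => T v) VA.L.zero_pos
  simp only [Ring.lie_def, LinearMap.sub_apply, Module.End.mul_apply, LinearMap.neg_apply,
    VA.L0_wt _ _ hv, map_smul] at h
  rw [sub_eq_iff_eq_add] at h
  rw [h]
  push_cast
  module

theorem divL1_mem_wt {h : ℤ} {v : V} (hv : v ∈ VA.wt h) (i : ℕ) :
    VA.divL1 i v ∈ VA.wt (h - i) := by
  refine Submodule.smul_mem _ _ ?_
  induction i with
  | zero => simpa using hv
  | succ i ih =>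
    rw [pow_succ', Module.End.mul_apply]
    have := VA.L1_mem_wt ih
    rwa [sub_sub, ← Nat.cast_add_one] at this

variable {VA}

theorem mode_mem_wt (hB : VA.IsMobius) {h k : ℤ} {u v : V} (hu : u ∈ VA.wt h) (hv : v ∈ VA.wt k)
    (q : ℤ) : mode VA.Y u q v ∈ VA.wt (h + k - q - 1) := by
  refine VA.mem_wt_of_L0 _ _ ?_
  have h := congrArg (fun T : Module.End ℂ V => T v) (hB u q).2.1
  simp only [Ring.lie_def, LinearMap.sub_apply, Module.End.mul_apply, LinearMap.add_apply,
    VA.L0_wt _ _ hv, VA.L0_wt _ _ hu, map_smul, mode_smul, VA.derivative, LinearMap.smul_apply,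
    add_sub_cancel_right] at h
  rw [sub_eq_iff_eq_add] at h
  rw [h]
  push_cast
  module

/-- In the bracket with `L(1)`, the derivative property turns the `L(-1)u` term into a multiple `-(q
+ 2)` of `u_{q+1}`, which joins the `2h` coming from `L(0)`. -/
theorem L1_mode (hB : VA.IsMobius) {h : ℤ} {u : V} (hu : u ∈ VA.wt h) (q : ℤ) (x : V) :
    VA.L.pos (mode VA.Y u q x) = mode VA.Y (VA.L.pos u) q x +
      ((2 * h - q - 2 : ℤ) : ℂ) • mode VA.Y u (q + 1) x + mode VA.Y u q (VA.L.pos x) := by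
  have h := congrArg (fun T : Module.End ℂ V => T x) (hB u q).2.2
  simp only [Ring.lie_def, LinearMap.sub_apply, Module.End.mul_apply, LinearMap.add_apply,
    VA.L0_wt _ _ hu, mode_smul, VA.derivative, LinearMap.smul_apply,
    show q + 2 - 1 = q + 1 by ring] at h
  rw [sub_eq_iff_eq_add] at h
  rw [h]
  push_cast
  module

/-- The component form of `e^{yL(1)} Y(u, x) e^{-yL(1)} =
Y(e^{y(1 - yx)L(1)} (1 - yx)^{-2L(0)} u, x / (1 - yx))`. -/
theorem divL1_mode (hB : VA.IsMobius) {h : ℤ} {u : V} (hu : u ∈ VA.wt h) (q : ℤ) (v : V) (p : ℕ) :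
    VA.divL1 p (mode VA.Y u q v) = tripleSum p fun i b c =>
      binom (2 * h - i - q - 2) b • mode VA.Y (VA.divL1 i u) (q + b) (VA.divL1 c v) := by
  induction p with
  | zero => simp [tripleSum, divL1_zero_apply]
  | succ p ih =>
    have hp : (p : ℂ) + 1 ≠ 0 := Nat.cast_add_one_ne_zero p
    -- Multiplying by `p + 1 = i + b + c` clears the divided power, so that `L(1)` can be applied to
    -- the formula for `p`.
    apply smul_right_injective V hp
    beta_reduce
    rw [← L1_divL1, ih]
    let G : ℕ → ℕ → ℕ → V := fun i b c => mode VA.Y (VA.divL1 i u) (q + b) (VA.divL1 c v)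
    -- `L(1)` raises the power on `u`, the mode index, or the power on `v`; `F₁`, `F₂`, `F₃` are
    -- these contributions reindexed by the raised triple. They add up to the formula for `p + 1` by
    -- Pascal's rule and `succ_mul_binom_succ`.
    let F₁ : ℕ → ℕ → ℕ → V := fun i b c => ((i : ℂ) * binom (2 * h - i - q - 1) b) • G i b c
    let F₂ : ℕ → ℕ → ℕ → V := fun i b c => match b with
      | 0 => 0
      | b + 1 => (((2 * h - 2 * i - q - b - 2 : ℤ) : ℂ) * binom (2 * h - i - q - 2) b) •
          G i (b + 1) c
    let F₃ : ℕ → ℕ → ℕ → V := fun i b c => ((c : ℂ) * binom (2 * h - i - q - 2) b) • G i b c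
    have h1 : VA.L.pos (tripleSum p fun i b c =>
        binom (2 * h - i - q - 2) b • mode VA.Y (VA.divL1 i u) (q + b) (VA.divL1 c v)) =
          tripleSum (p + 1) F₁ + tripleSum (p + 1) F₂ + tripleSum (p + 1) F₃ := by
      rw [tripleSum_succ_left (F := F₁) (by simp [F₁]),
        tripleSum_succ_middle (F := F₂) (by simp [F₂]),
        tripleSum_succ_right (F := F₃) (by simp [F₃]), ← tripleSum_add, ← tripleSum_add]
      simp only [tripleSum, map_sum, map_smul]
      refine sum_congr rfl fun x _ => sum_congr rfl fun y _ => ?_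
      rw [L1_mode hB (VA.divL1_mem_wt hu x.1), L1_divL1, L1_divL1]
      simp only [F₁, F₂, F₃, G, mode_smul, LinearMap.smul_apply, map_smul]
      rw [show (2 * h - ((x.1 + 1 : ℕ) : ℤ) - q - 1) = 2 * h - x.1 - q - 2 by push_cast; ring,
        show q + ((y.1 + 1 : ℕ) : ℤ) = q + y.1 + 1 by push_cast; ring]
      push_cast
      module
    have h2 : ((p : ℂ) + 1) • (tripleSum (p + 1) fun i b c =>
        binom (2 * h - i - q - 2) b • mode VA.Y (VA.divL1 i u) (q + b) (VA.divL1 c v)) =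
          tripleSum (p + 1) fun i b c =>
            ((p : ℂ) + 1) • binom (2 * h - i - q - 2) b • G i b c := by
      simp only [tripleSum, smul_sum, G]
    rw [h1, h2, ← tripleSum_add, ← tripleSum_add]
    refine tripleSum_congr fun i b c hibc => ?_
    have hpc : (p : ℂ) + 1 = i + b + c := by exact_mod_cast hibc.symm
    simp only [F₁, F₂, F₃]
    cases b with
    | zero =>
      simp only [binom_zero_right, hpc, Nat.cast_zero]
      module
    | succ b =>
      have h3 := binom_succ_succ (2 * h - i - q - 2) b
      have h4 := succ_mul_binom_succ (2 * h - i - q - 2) b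
      rw [show 2 * h - (i : ℤ) - q - 2 + 1 = 2 * h - i - q - 1 by ring] at h3
      simp only []
      rw [smul_smul, ← add_smul, ← add_smul, h3, hpc]
      congr 1
      push_cast at h4 ⊢
      linear_combination -h4

end StronglyGradedVertexAlgebra

end Sl2

/-! ### Substitutions in rational functions. -/

section Subst

theorem subst_X (a : RatFunc ℂ) (ha : Transcendental ℂ a) : subst a ha RatFunc.X = a := by
  have h : (RatFunc.algEquivOfTranscendental a ha RatFunc.X : RatFunc ℂ) = a := by
    rw [← RatFunc.algebraMap_X, RatFunc.algEquivOfTranscendental_algebraMap]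
    simp
  exact h

theorem invert_X : invert RatFunc.X = RatFunc.X⁻¹ := subst_X _ _

theorem translate_X (y : ℂ) : translate y RatFunc.X = RatFunc.X + RatFunc.C y := subst_X _ _

theorem algHom_C (φ : RatFunc ℂ →ₐ[ℂ] RatFunc ℂ) (y : ℂ) : φ (RatFunc.C y) = RatFunc.C y := by
  rw [← RatFunc.algebraMap_eq_C, φ.commutes]

theorem translate_zero (f : RatFunc ℂ) : translate 0 f = f := by
  induction f using RatFunc.induction_on with
  | f p q hq =>
    have hp (p : Polynomial ℂ) : translate 0 (algebraMap _ _ p) = algebraMap _ (RatFunc ℂ) p := by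
      induction p using Polynomial.induction_on' with
      | add p q hp hq => rw [map_add, map_add, hp, hq]
      | monomial n a =>
        rw [← Polynomial.C_mul_X_pow_eq_monomial, map_mul, map_mul, map_pow, map_pow,
          RatFunc.algebraMap_X, RatFunc.algebraMap_C, translate_X, algHom_C, map_zero, add_zero]
    rw [map_div₀, hp, hp]

theorem translate_X_zpow (y : ℂ) (a : ℤ) :
    translate y (RatFunc.X ^ a) = (RatFunc.X + RatFunc.C y) ^ a := by
  rw [map_zpow₀, translate_X]

/-- The composite substitution is `t ↦ (t + y)⁻¹`, under which the local coordinate `t⁻¹ - y`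
becomes `t` itself. -/
theorem translate_invert_X_zpow_mul (y : ℂ) (a q : ℤ) :
    translate y (invert (RatFunc.X ^ a * (RatFunc.X⁻¹ - RatFunc.C y) ^ q)) =
      (RatFunc.X + RatFunc.C y) ^ (-a) * RatFunc.X ^ q := by
  simp only [map_mul, map_zpow₀, map_sub, map_inv₀, invert_X, translate_X, algHom_C, inv_inv,
    add_sub_cancel_right, inv_zpow, zpow_neg]

end Subst

/-! ### Opposite operators and their Jacobi identity. -/

section Opp

variable {At : Type*} [AddCommGroup At] {A : AddSubgroup At}
  {V : Type*} [AddCommGroup V] [Module ℂ V]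

namespace StronglyGradedVertexAlgebra

variable (VA : StronglyGradedVertexAlgebra A V)

theorem ofWeights_apply {U : Type*} [AddCommGroup U] [Module ℂ U] (F : ℤ → V →ₗ[ℂ] U) {h : ℤ}
    {v : V} (hv : v ∈ VA.wt h) : VA.ofWeights F v = F h v := by
  have : VA.weightEquiv.symm v = DirectSum.lof ℂ ℤ (fun n => VA.wt n) h ⟨v, hv⟩ := by
    rw [LinearEquiv.symm_apply_eq]
    exact (DirectSum.coeLinearMap_lof VA.wt h ⟨v, hv⟩).symm
  rw [ofWeights, LinearMap.comp_apply, LinearEquiv.coe_coe, this, DirectSum.toModule_lof]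
  rfl

/-- Local nilpotency of `L(1)` bounds the sum by a number depending on `v` alone, so the same
truncation works for every `f`. -/
theorem eventually_opp_tmul {h : ℤ} {v : V} (hv : v ∈ VA.wt h) :
    ∀ᶠ I in atTop, ∀ f : RatFunc ℂ, VA.opp (v ⊗ₜ f) = ∑ i ∈ range I,
      (-1 : ℂ) ^ h • (VA.divL1 i v ⊗ₜ[ℂ] (RatFunc.X ^ (2 * h - i - 2) * invert f)) := by
  obtain ⟨N, hN⟩ := VA.exists_divL1_eq_zero v
  filter_upwards [eventually_ge_atTop N] with I hI f
  have key : VA.oppVec v = ∑ i ∈ range I,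
      (-1 : ℂ) ^ h • (VA.divL1 i v ⊗ₜ[ℂ] (RatFunc.X ^ (2 * h - i - 2) : RatFunc ℂ)) := by
    have hterm (i : ℕ) : VA.oppTerm h v i =
        (-1 : ℂ) ^ h • (VA.divL1 i v ⊗ₜ[ℂ] (RatFunc.X ^ (2 * h - i - 2) : RatFunc ℂ)) := by
      rw [oppTerm, divL1, LinearMap.smul_apply, ← TensorProduct.smul_tmul', smul_smul]
    rw [oppVec, ofWeights_apply VA _ hv]
    change ∑ᶠ i, VA.oppTerm h v i = _
    rw [(finsum_eq_sum_range_comp (φ := id) Function.injective_id (J := I) ?_).2]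
    · exact sum_congr rfl fun i _ => hterm i
    · intro i hi
      refine ⟨i, ?_, rfl⟩
      by_contra hlt
      exact hi (by rw [hterm, hN i (by omega), TensorProduct.zero_tmul, smul_zero])
  rw [opp_tmul, key, map_sum]
  refine sum_congr rfl fun i _ => ?_
  rw [map_smul, LinearMap.lTensor_tmul, LinearMap.mul_apply', mul_comm]

variable {W : Type*} [AddCommGroup W] [Module ℂ W] (Y : V →ₗ[ℂ] VertexOperator ℂ W)

/-- The action `τ_W ∘ ι₊ ∘ T_y ∘ o` of `V ⊗ ℂ(t)` on `W`. -/
def oppAct (y : ℂ) : V ⊗[ℂ] RatFunc ℂ →ₗ[ℂ] Module.End ℂ W :=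
  tauW Y ∘ₗ LinearMap.lTensor V (iotaPlus ∘ₗ (translate y).toLinearMap) ∘ₗ VA.opp

theorem eventually_oppAct_tmul (y : ℂ) {h : ℤ} {v : V} (hv : v ∈ VA.wt h) :
    ∀ᶠ I in atTop, ∀ f : RatFunc ℂ, VA.oppAct Y y (v ⊗ₜ f) = ∑ i ∈ range I,
      (-1 : ℂ) ^ h • tauW Y (VA.divL1 i v ⊗ₜ[ℂ] (iotaPlus
        ((RatFunc.X + RatFunc.C y) ^ (2 * h - i - 2) * translate y (invert f)))) := by
  filter_upwards [VA.eventually_opp_tmul hv] with I hI f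
  rw [oppAct, LinearMap.comp_apply, LinearMap.comp_apply, hI, map_sum, map_sum]
  refine sum_congr rfl fun i _ => ?_
  rw [map_smul, map_smul, LinearMap.lTensor_tmul, LinearMap.comp_apply, AlgHom.toLinearMap_apply,
    map_mul, translate_X_zpow]

theorem eventually_oppAct_tmul_X_zpow_mul (y : ℂ) {h : ℤ} {v : V} (hv : v ∈ VA.wt h) :
    ∀ᶠ I in atTop, ∀ a q : ℤ,
      VA.oppAct Y y (v ⊗ₜ (RatFunc.X ^ a * (RatFunc.X⁻¹ - RatFunc.C y) ^ q)) =
      ∑ i ∈ range I, (-1 : ℂ) ^ h • tauW Y (VA.divL1 i v ⊗ₜ[ℂ] (HahnSeries.single q 1 * iotaPlus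
        ((RatFunc.X + RatFunc.C y) ^ (2 * h - i - 2 - a)))) := by
  filter_upwards [VA.eventually_oppAct_tmul Y y hv] with I hI a q
  rw [hI]
  refine sum_congr rfl fun i _ => ?_
  rw [translate_invert_X_zpow_mul, ← mul_assoc, ← zpow_add₀ (X_add_C_ne_zero y), ← sub_eq_add_neg,
    iotaPlus_mul, iotaPlus_X_zpow, mul_comm]

/-- The Jacobi identity for the opposite operators, paired with
`t₁ ^ m t₂ ^ n (t₁ - t₂) ^ l`, for homogeneous vectors. -/
theorem eventually_oppAct_jacobi_of_mem (hB : VA.IsMobius)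
    (hJ : ∀ u v w, JacobiOn (fun a n b => mode VA.Y a n b) (fun a n b => mode Y a n b) u v w)
    (y : ℂ) {h k : ℤ} {u v : V} (hu : u ∈ VA.wt h) (hv : v ∈ VA.wt k) (l m n : ℤ) (w : W) :
    ∀ᶠ J in atTop,
      ∑ j ∈ range J, ((-1) ^ j * binom l j) •
          VA.oppAct Y y (v ⊗ₜ (RatFunc.X ^ (n + l) * (RatFunc.X⁻¹ - RatFunc.C y) ^ (l - j)))
            (VA.oppAct Y y
              (u ⊗ₜ (RatFunc.X ^ (m + l) * (RatFunc.X⁻¹ - RatFunc.C y) ^ (j : ℤ))) w) -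
        ∑ j ∈ range J, ((-1) ^ l * ((-1) ^ j * binom l j)) •
          VA.oppAct Y y (u ⊗ₜ (RatFunc.X ^ (m + l) * (RatFunc.X⁻¹ - RatFunc.C y) ^ (l - j)))
            (VA.oppAct Y y
              (v ⊗ₜ (RatFunc.X ^ (n + l) * (RatFunc.X⁻¹ - RatFunc.C y) ^ (j : ℤ))) w) =
      ∑ j ∈ range J, binom m j •
        VA.oppAct Y y (mode VA.Y u (l + j) v ⊗ₜ (RatFunc.X ^ (m + n - j))) w := by
  obtain ⟨I, hIu, hIv, hI1, hI2⟩ := ((VA.eventually_oppAct_tmul_X_zpow_mul Y y hu).and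
    ((VA.eventually_oppAct_tmul_X_zpow_mul Y y hv).and
    (((eventually_ge_atTop _).and (eventually_ge_atTop _)))) :
      ∀ᶠ I in atTop, _ ∧ _ ∧ (VA.exists_divL1_eq_zero u).choose ≤ I ∧
        (VA.exists_divL1_eq_zero v).choose ≤ I).exists
  have hu0 (i : ℕ) (hi : I ≤ i) : VA.divL1 i u = 0 :=
    (VA.exists_divL1_eq_zero u).choose_spec i (hI1.trans hi)
  have hv0 (i : ℕ) (hi : I ≤ i) : VA.divL1 i v = 0 :=
    (VA.exists_divL1_eq_zero v).choose_spec i (hI2.trans hi)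
  let f : ℕ → LaurentSeries ℂ := fun i =>
    iotaPlus ((RatFunc.X + RatFunc.C y) ^ (2 * h - i - 2 - (m + l)))
  let g : ℕ → LaurentSeries ℂ := fun c =>
    iotaPlus ((RatFunc.X + RatFunc.C y) ^ (2 * k - c - 2 - (n + l)))
  -- Both sides reduce to combinations of these terms: the right side by conjugating the iterate
  -- with `L(1)` (`hR`), the left side by the module Jacobi identity for each pair of divided powers
  -- (`hT`).
  let T : ℕ → ℕ → ℕ → W := fun i r c => tauW Y (mode VA.Y (VA.divL1 i u) (l + r) (VA.divL1 c v) ⊗ₜ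
    iotaPlus ((RatFunc.X + RatFunc.C y) ^ (2 * h + 2 * k - 4 - m - n - 2 * l - i - c - r))) w
  have hjac : ∀ᶠ J in atTop, ∀ i ∈ range I, ∀ c ∈ range I, _ :=
    (eventually_all_finset (range I)).mpr fun i _ => (eventually_all_finset (range I)).mpr
      fun c _ => eventually_tauW_jacobi (hJ (VA.divL1 i u) (VA.divL1 c v) w) (f i) (g c) l
  have hbound : ∀ᶠ J in atTop, ∀ i ∈ range I, ∀ c ∈ range I, ∀ r : ℕ, J ≤ r →
      mode VA.Y (VA.divL1 i u) (l + r) (VA.divL1 c v) = 0 := by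
    refine (eventually_all_finset (range I)).mpr fun i _ => (eventually_all_finset (range I)).mpr
      fun c _ => ?_
    obtain ⟨N, hN⟩ := exists_mode_eq_zero VA.Y (VA.divL1 i u) (VA.divL1 c v)
    filter_upwards [eventually_ge_atTop (N - l).toNat] with J hJ r hr
    exact hN _ (by omega)
  filter_upwards [hjac, hbound] with J hjac hbound
  have hT0 (i r c : ℕ) (hr : I ≤ i ∨ J ≤ r ∨ I ≤ c) : T i r c = 0 := by
    have : mode VA.Y (VA.divL1 i u) (l + r) (VA.divL1 c v) = 0 := by
      by_cases hi : I ≤ i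
      · rw [hu0 i hi]; simp
      by_cases hc : I ≤ c
      · rw [hv0 c hc]; simp
      exact hbound i (by simpa using hi) c (by simpa using hc) r (by omega)
    simp only [T, this, TensorProduct.zero_tmul, map_zero, LinearMap.zero_apply]
  have hsq : ((-1 : ℂ) ^ l) * (-1) ^ l = 1 := by
    rw [← zpow_add₀ (by norm_num), Even.neg_one_zpow ⟨l, rfl⟩]
  have hR : ∑ j ∈ range J, binom m j •
        VA.oppAct Y y (mode VA.Y u (l + j) v ⊗ₜ (RatFunc.X ^ (m + n - j))) w =
      ∑ i ∈ range I, ∑ c ∈ range I, ∑ r ∈ range J,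
        (-((-1) ^ l * ((-1) ^ h * (-1) ^ k)) * binom (2 * h - i - 2 - (m + l)) r) • T i r c := by
    have hterm (j : ℕ) (hj : j ∈ range J) : binom m j •
        VA.oppAct Y y (mode VA.Y u (l + j) v ⊗ₜ (RatFunc.X ^ (m + n - j))) w =
        ∑ i ∈ range I, ∑ c ∈ range I, ∑ b ∈ range (J - j),
          (-((-1) ^ l * ((-1) ^ h * (-1) ^ k)) *
            ((-1) ^ j * binom m j * binom (2 * h - i - l - 2 - j) b)) • T i (j + b) c := by
      -- `P` is large enough for the sum over total degrees `p < P` to contain the box of nonzero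
      -- terms, where `i, c < I` and `b < J - j`.
      obtain ⟨P, hP, hle⟩ := ((VA.eventually_oppAct_tmul Y y (mode_mem_wt hB hu hv (l + j))).and
        (eventually_ge_atTop (I + (J - j) + I))).exists
      have hp (p : ℕ) : tauW Y (VA.divL1 p (mode VA.Y u (l + j) v) ⊗ₜ[ℂ] (iotaPlus
          ((RatFunc.X + RatFunc.C y) ^ (2 * (h + k - (l + j) - 1) - p - 2) *
            translate y (invert (RatFunc.X ^ (m + n - j)))))) w =
          tripleSum p fun i b c => binom (2 * h - i - l - 2 - j) b • T i (j + b) c := by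
        rw [divL1_mode hB hu]
        simp only [tripleSum, TensorProduct.sum_tmul, map_sum, LinearMap.sum_apply]
        refine sum_congr rfl fun x hx => sum_congr rfl fun z hz => ?_
        rw [HasAntidiagonal.mem_antidiagonal] at hx hz
        rw [← TensorProduct.smul_tmul', map_smul, LinearMap.smul_apply, map_zpow₀, invert_X,
          map_zpow₀, map_inv₀, translate_X, inv_zpow', ← zpow_add₀ (X_add_C_ne_zero y)]
        simp only [T]
        congr 2
        · ring
        · congr 3
          · rw [Nat.cast_add, add_assoc]
          · congr 1; push_cast [← hx, ← hz]; ring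
      rw [hP]
      simp only [LinearMap.sum_apply, LinearMap.smul_apply, hp]
      rw [← smul_sum, sum_range_tripleSum hle]
      · have hsign : (-1 : ℂ) ^ (h + k - (l + j) - 1) =
            -((-1) ^ l * ((-1) ^ h * (-1) ^ k)) * (-1) ^ j := by
          have h1 : ((-1 : ℂ) ^ l)⁻¹ = (-1) ^ l := inv_eq_of_mul_eq_one_left hsq
          have h2 : ((-1 : ℂ) ^ j)⁻¹ = (-1) ^ j := by rw [← inv_pow]; norm_num
          rw [zpow_sub₀ (by norm_num), zpow_sub₀ (by norm_num), zpow_add₀ (by norm_num),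
            zpow_add₀ (by norm_num), zpow_natCast, div_eq_mul_inv, div_eq_mul_inv, mul_inv, h1, h2]
          norm_num
          ring
        simp only [smul_sum, smul_smul, hsign]
        refine sum_congr rfl fun i _ => ?_
        rw [sum_comm]
        refine sum_congr rfl fun c _ => sum_congr rfl fun b _ => ?_
        congr 1
        ring
      · intro i b c hi
        rw [hT0 i (j + b) c (Or.inl hi), smul_zero]
      · intro i b c hb
        rw [hT0 i (j + b) c (Or.inr (Or.inl (by omega))), smul_zero]
      · intro i b c hc
        rw [hT0 i (j + b) c (Or.inr (Or.inr hc)), smul_zero]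
    rw [sum_congr rfl hterm, sum_comm]
    refine sum_congr rfl fun i _ => ?_
    rw [sum_comm]
    refine sum_congr rfl fun c _ => ?_
    rw [← sum_range_diag_flip J fun j b => (-((-1) ^ l * ((-1) ^ h * (-1) ^ k)) *
            ((-1) ^ j * binom m j * binom (2 * h - i - l - 2 - j) b)) • T i (j + b) c]
    refine sum_congr rfl fun r _ => ?_
    -- With `r = j + b` fixed, the convolution identity sums over `j` to the binomial coefficient
    -- that the Hasse derivative produces on the left side.
    rw [show 2 * h - (i : ℤ) - 2 - (m + l) = 2 * h - i - l - 2 - m by ring,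
      ← sum_neg_one_pow_mul_binom_mul_binom, mul_sum, sum_smul]
    refine sum_congr rfl fun j hj => ?_
    rw [Nat.add_sub_cancel' (by simpa [Nat.lt_succ_iff] using hj)]
  rw [hR]
  have hT (i c r : ℕ) :
      tauW Y (mode VA.Y (VA.divL1 i u) (l + r) (VA.divL1 c v) ⊗ₜ
        (LaurentSeries.hasseDeriv ℂ r (f i) * g c)) w =
      binom (2 * h - i - 2 - (m + l)) r • T i r c := by
    simp only [f, g, T]
    rw [hasseDeriv_iotaPlus_X_add_C_zpow, laurent_smul_mul, TensorProduct.tmul_smul, map_smul,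
      LinearMap.smul_apply, ← iotaPlus_mul, ← zpow_add₀ (X_add_C_ne_zero y)]
    congr 6
    ring
  have hexp {u v : V} {h k a b : ℤ} {f g : ℕ → LaurentSeries ℂ} {p q : ℤ}
      (hu : VA.oppAct Y y (u ⊗ₜ (RatFunc.X ^ a * (RatFunc.X⁻¹ - RatFunc.C y) ^ p)) =
        ∑ i ∈ range I, (-1 : ℂ) ^ h • tauW Y (VA.divL1 i u ⊗ₜ[ℂ] (HahnSeries.single p 1 * f i)))
      (hv : VA.oppAct Y y (v ⊗ₜ (RatFunc.X ^ b * (RatFunc.X⁻¹ - RatFunc.C y) ^ q)) =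
        ∑ i ∈ range I, (-1 : ℂ) ^ k • tauW Y (VA.divL1 i v ⊗ₜ[ℂ] (HahnSeries.single q 1 * g i))) :
      VA.oppAct Y y (u ⊗ₜ (RatFunc.X ^ a * (RatFunc.X⁻¹ - RatFunc.C y) ^ p))
        (VA.oppAct Y y (v ⊗ₜ (RatFunc.X ^ b * (RatFunc.X⁻¹ - RatFunc.C y) ^ q)) w) =
      ∑ i ∈ range I, ∑ c ∈ range I, ((-1 : ℂ) ^ h * (-1) ^ k) •
        tauW Y (VA.divL1 i u ⊗ₜ[ℂ] (HahnSeries.single p 1 * f i))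
          (tauW Y (VA.divL1 c v ⊗ₜ[ℂ] (HahnSeries.single q 1 * g c)) w) := by
    rw [hu, hv]
    simp only [LinearMap.sum_apply, LinearMap.smul_apply, map_sum, map_smul, smul_sum, smul_smul]
    rw [sum_comm, mul_comm]
  -- Opposition reverses the order of the operators, so the two products of the module identity
  -- trade places; the factor `-(-1) ^ l` accounts for this, and `(-1) ^ h (-1) ^ k` comes from the
  -- two opposite vectors.
  have hsum : ∑ i ∈ range I, ∑ c ∈ range I, _ = ∑ i ∈ range I, ∑ c ∈ range I, _ :=
    sum_congr rfl fun i hi => sum_congr rfl fun c hc =>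
      congrArg (fun x => (-((-1) ^ l * ((-1) ^ h * (-1) ^ k) : ℂ)) • x) (hjac i hi c hc)
  simp only [hT, smul_sum, smul_smul, smul_sub, sum_sub_distrib] at hsum
  rw [← hsum]
  simp only [hexp (hIv _ _) (hIu _ _), hexp (hIu _ _) (hIv _ _), smul_sum, smul_smul]
  have comm (F : ℕ → ℕ → ℕ → W) : ∑ j ∈ range J, ∑ i ∈ range I, ∑ c ∈ range I, F i c j =
      ∑ i ∈ range I, ∑ c ∈ range I, ∑ j ∈ range J, F i c j := by
    rw [sum_comm]
    exact sum_congr rfl fun i _ => sum_comm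
  have comm' (F : ℕ → ℕ → ℕ → W) : ∑ j ∈ range J, ∑ c ∈ range I, ∑ i ∈ range I, F i c j =
      ∑ i ∈ range I, ∑ c ∈ range I, ∑ j ∈ range J, F i c j := by
    rw [comm fun c i j => F i c j, sum_comm]
  rw [comm', comm, sub_eq_neg_add, sub_eq_add_neg]
  simp only [← sum_neg_distrib]
  congr 1
  · refine sum_congr rfl fun i _ => sum_congr rfl fun c _ => sum_congr rfl fun j _ => ?_
    rw [← neg_smul]
    congr 1
    ring
  · refine sum_congr rfl fun i _ => sum_congr rfl fun c _ => sum_congr rfl fun j _ => ?_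
    rw [← neg_smul]
    congr 1
    linear_combination (-(-1) ^ h * (-1) ^ k * (-1) ^ j * binom l j) * hsq

/-- The Jacobi identity for the opposite operators, paired with
`t₁ ^ m t₂ ^ n (t₁ - t₂) ^ l`. -/
theorem eventually_oppAct_jacobi (hB : VA.IsMobius)
    (hJ : ∀ u v w, JacobiOn (fun a n b => mode VA.Y a n b) (fun a n b => mode Y a n b) u v w)
    (y : ℂ) (u v : V) (l m n : ℤ) (w : W) :
    ∀ᶠ J in atTop,
      ∑ j ∈ range J, ((-1) ^ j * binom l j) •
          VA.oppAct Y y (v ⊗ₜ (RatFunc.X ^ (n + l) * (RatFunc.X⁻¹ - RatFunc.C y) ^ (l - j)))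
            (VA.oppAct Y y
              (u ⊗ₜ (RatFunc.X ^ (m + l) * (RatFunc.X⁻¹ - RatFunc.C y) ^ (j : ℤ))) w) -
        ∑ j ∈ range J, ((-1) ^ l * ((-1) ^ j * binom l j)) •
          VA.oppAct Y y (u ⊗ₜ (RatFunc.X ^ (m + l) * (RatFunc.X⁻¹ - RatFunc.C y) ^ (l - j)))
            (VA.oppAct Y y
              (v ⊗ₜ (RatFunc.X ^ (n + l) * (RatFunc.X⁻¹ - RatFunc.C y) ^ (j : ℤ))) w) =
      ∑ j ∈ range J, binom m j •
        VA.oppAct Y y (mode VA.Y u (l + j) v ⊗ₜ (RatFunc.X ^ (m + n - j))) w := by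
  have hu : u ∈ ⨆ h, VA.wt h := by rw [VA.wt_grading.2]; trivial
  have hv : v ∈ ⨆ h, VA.wt h := by rw [VA.wt_grading.2]; trivial
  induction hu using Submodule.iSup_induction' with
  | zero => simp
  | add u u' _ _ hu hu' =>
    filter_upwards [hu, hu'] with J h1 h2
    simp only [TensorProduct.add_tmul, map_add, LinearMap.add_apply, mode_add, smul_add,
      sum_add_distrib, ← h1, ← h2]
    abel
  | mem h u hu =>
    induction hv using Submodule.iSup_induction' with
    | zero => simp
    | add v v' _ _ hv hv' =>
      filter_upwards [hv, hv'] with J h1 h2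
      simp only [TensorProduct.add_tmul, map_add, LinearMap.add_apply, smul_add,
        sum_add_distrib, ← h1, ← h2]
      abel
    | mem k v hv => exact VA.eventually_oppAct_jacobi_of_mem Y hB hJ y hu hv l m n w

/-- Expansion of `(c + s) ^ p` in powers of the local coordinate `s = t⁻¹ - y`. -/
theorem eventually_oppAct_expansion (y : ℂ) (v : V) (f : RatFunc ℂ) (w : W) :
    ∀ᶠ K in atTop, ∀ c : ℂ, c ≠ 0 → ∀ p : ℤ,
      VA.oppAct Y y (v ⊗ₜ (f * (RatFunc.X⁻¹ - RatFunc.C y + RatFunc.C c) ^ p)) w =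
        ∑ k ∈ range K, (binom p k * c ^ (p - k)) •
          VA.oppAct Y y (v ⊗ₜ (f * (RatFunc.X⁻¹ - RatFunc.C y) ^ (k : ℤ))) w := by
  have hv : v ∈ ⨆ h, VA.wt h := by rw [VA.wt_grading.2]; trivial
  induction hv using Submodule.iSup_induction' with
  | zero => simp
  | add v v' _ _ hv hv' =>
    filter_upwards [hv, hv'] with K h1 h2 c hc p
    simp only [TensorProduct.add_tmul, map_add, LinearMap.add_apply, smul_add, sum_add_distrib,
      ← h1 c hc p, ← h2 c hc p]
  | mem h v hv =>
    obtain ⟨I, hI⟩ := (VA.eventually_oppAct_tmul Y y hv).exists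
    have hK : ∀ᶠ K in atTop, ∀ i ∈ range I, _ := (eventually_all_finset (range I)).mpr fun i _ =>
      eventually_apply_mul_X_add_C_zpow
        (Φ := (LinearMap.applyₗ w) ∘ₗ tauW Y ∘ₗ TensorProduct.mk ℂ V _ (VA.divL1 i v))
        (vanishesAtHighOrder_tauW Y (VA.divL1 i v) w)
        (iotaPlus ((RatFunc.X + RatFunc.C y) ^ (2 * h - i - 2) * translate y (invert f)))
    filter_upwards [hK] with K hK c hc p
    simp only [hI, LinearMap.sum_apply, LinearMap.smul_apply, smul_sum]
    rw [sum_comm]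
    refine sum_congr rfl fun i hi => ?_
    have hKi := hK i hi c hc p
    simp only [LinearMap.comp_apply, TensorProduct.mk_apply, LinearMap.applyₗ_apply_apply,
      ← iotaPlus_X_zpow, ← iotaPlus_mul] at hKi
    have e1 : translate y (invert (f * (RatFunc.X⁻¹ - RatFunc.C y + RatFunc.C c) ^ p)) =
        translate y (invert f) * (RatFunc.X + RatFunc.C c) ^ p := by
      simp only [map_mul, map_zpow₀, map_add, map_sub, map_inv₀, invert_X, translate_X, algHom_C,
        inv_inv, add_sub_cancel_right]
    have e2 (k : ℤ) : translate y (invert (f * (RatFunc.X⁻¹ - RatFunc.C y) ^ k)) =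
        translate y (invert f) * RatFunc.X ^ k := by
      simp only [map_mul, map_zpow₀, map_sub, map_inv₀, invert_X, translate_X, algHom_C,
        inv_inv, add_sub_cancel_right]
    simp only [e1, e2, ← mul_assoc]
    rw [hKi, smul_sum]
    exact sum_congr rfl fun k _ => smul_comm _ _ _

end StronglyGradedVertexAlgebra

end Opp

/-! ### The action on compatible functionals. -/

section TauP

variable {At : Type*} [AddCommGroup At] {A : AddSubgroup At}
  {V : Type*} [AddCommGroup V] [Module ℂ V] {VA : StronglyGradedVertexAlgebra A V}
  {W₁ W₂ : Type*} [AddCommGroup W₁] [Module ℂ W₁] [AddCommGroup W₂] [Module ℂ W₂]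
  {M₁ : StronglyGradedGenModule VA W₁} {M₂ : StronglyGradedGenModule VA W₂} {z : ℂ}
  {lam : Module.Dual ℂ (W₁ ⊗[ℂ] W₂)}

theorem tauP_apply_tmul (ξ : V ⊗[ℂ] RatFunc ℂ) (lam : Module.Dual ℂ (W₁ ⊗[ℂ] W₂))
    (w₁ : W₁) (w₂ : W₂) :
    tauP z M₁ M₂ ξ lam (w₁ ⊗ₜ w₂) =
      lam (VA.oppAct M₁.Y z ξ w₁ ⊗ₜ w₂) + lam (w₁ ⊗ₜ VA.oppAct M₂.Y 0 ξ w₂) := by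
  have h : iotaPlus ∘ₗ (translate 0).toLinearMap = iotaPlus :=
    LinearMap.ext fun f => congrArg iotaPlus (translate_zero f)
  simp only [tauP, StronglyGradedVertexAlgebra.oppAct, h]
  rfl

/-- The compatibility condition in components. -/
theorem Compatible.tauP_eq_sum (hlam : Compatible z M₁ M₂ lam) {v : V} {N : ℤ}
    (hN : ∀ n, N ≤ n → YP z M₁ M₂ v n lam = 0) {p q : ℤ} {K : ℕ} (hK : N ≤ q - p + K) :
    tauP z M₁ M₂ (v ⊗ₜ (RatFunc.X ^ q * (RatFunc.X⁻¹ - RatFunc.C z) ^ p)) lam =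
      ∑ k ∈ range K, (binom p k * (-z) ^ k) • YP z M₁ M₂ v (q - p + k) lam := by
  -- The coefficient of `x₀ ^ (-p - 1) x₁ ^ (-q - 1)`; its terms are indexed by the power `k` of
  -- `z`, and lower truncation leaves only `k < K`.
  have h := congrFun (hlam.2 v) (-p - 1, -q - 1)
  simp only [deltaYt, neg_sub, sub_neg_eq_add, add_sub_cancel_left] at h
  rw [mul_comm, h, mulSeries]
  rw [(finsum_eq_sum_range_comp (J := K) (φ := fun k : ℕ => ((-p - 1, k - p) : ℤ × ℤ)) ?_ ?_).2]
  · refine sum_congr rfl fun k _ => ?_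
    simp only [Prod.mk_sub_mk, sub_self, if_true, deltaInv]
    rw [show -(-p - 1) - 1 = p by ring, show -((k : ℤ) - p) = p - k by ring,
      show p + ((k : ℤ) - p) = k by ring, subPowCoeff_natCast, zpow_natCast, neg_pow z]
    congr 1
    · ring
    · congr 1
      ring
  · intro i j hij
    simpa using hij
  · rintro ⟨i, j⟩ hne
    simp only [Prod.mk_sub_mk, deltaInv] at hne
    have h1 := left_ne_zero_of_mul (left_ne_zero_of_smul hne)
    have h2 := right_ne_zero_of_smul hne
    by_cases hi : -p - 1 - i = 0
    · rw [if_pos hi] at h2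
      have h3 : 0 ≤ -i - 1 + j ∧ -j + (-i - 1 + j) = -i - 1 := by
        by_contra h'; exact h1 (subPowCoeff_eq_zero h')
      have h4 : ¬ N ≤ -(-q - 1 - j) - 1 := fun h' => h2 (hN _ h')
      refine ⟨(j + p).toNat, by omega, ?_⟩
      ext <;> simp <;> omega
    · exact (h2 (if_neg hi)).elim

/-- The binomial theorem for `t⁻¹ = (t⁻¹ - z) + z`. The exponent `j` is natural, so the expansion is
finite and exact. -/
theorem X_zpow_sub_natCast (z : ℂ) (a : ℤ) (j : ℕ) :
    (RatFunc.X : RatFunc ℂ) ^ (a - j) = ∑ i ∈ range (j + 1),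
      ((j.choose i : ℂ) * z ^ (j - i)) •
        (RatFunc.X ^ a * (RatFunc.X⁻¹ - RatFunc.C z) ^ (i : ℤ)) := by
  have h := add_pow ((RatFunc.X : RatFunc ℂ)⁻¹ - RatFunc.C z) (RatFunc.C z) j
  rw [sub_add_cancel] at h
  rw [zpow_sub₀ RatFunc.X_ne_zero, zpow_natCast, div_eq_mul_inv, ← inv_pow, h, mul_sum]
  refine sum_congr rfl fun i _ => ?_
  rw [RatFunc.smul_eq_C_mul, map_mul, map_pow, map_natCast, zpow_natCast]
  ring

/-- Re-expansion, around `t₁ = z⁻¹`, of the pairing with `t₁ ^ m t₂ ^ n (t₁ - t₂) ^ l` where `t₂` is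
near `0`. -/
theorem Compatible.sum_YP_oppAct (hlam : Compatible z M₁ M₂ lam) {v : V} {N : ℤ}
    (hN : ∀ n, N ≤ n → YP z M₁ M₂ v n lam = 0) (u : V) (l m n : ℤ) (w₁ : W₁) (w₂ : W₂) {J : ℕ}
    (hJ : N ≤ n + J) :
    ∑ j ∈ range J, ((-1) ^ j * binom l j) • YP z M₁ M₂ v (n + j) lam
        (VA.oppAct M₁.Y z (u ⊗ₜ (RatFunc.X ^ (m + l - j))) w₁ ⊗ₜ w₂) =
      ∑ j ∈ range J, ((-1) ^ j * binom l j) • tauP z M₁ M₂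
        (v ⊗ₜ (RatFunc.X ^ (n + l) * (RatFunc.X⁻¹ - RatFunc.C z) ^ (l - j))) lam
        (VA.oppAct M₁.Y z
          (u ⊗ₜ (RatFunc.X ^ (m + l) * (RatFunc.X⁻¹ - RatFunc.C z) ^ (j : ℤ))) w₁ ⊗ₜ w₂) := by
  let E : ℕ → ℕ → ℂ := fun i j => YP z M₁ M₂ v (n + j) lam (VA.oppAct M₁.Y z
    (u ⊗ₜ (RatFunc.X ^ (m + l) * (RatFunc.X⁻¹ - RatFunc.C z) ^ (i : ℤ))) w₁ ⊗ₜ w₂)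
  have hR (i : ℕ) (hi : i ∈ range J) : ((-1) ^ i * binom l i) • tauP z M₁ M₂
        (v ⊗ₜ (RatFunc.X ^ (n + l) * (RatFunc.X⁻¹ - RatFunc.C z) ^ (l - i))) lam
        (VA.oppAct M₁.Y z
          (u ⊗ₜ (RatFunc.X ^ (m + l) * (RatFunc.X⁻¹ - RatFunc.C z) ^ (i : ℤ))) w₁ ⊗ₜ w₂) =
      ∑ k ∈ range (J - i),
        ((-1) ^ i * binom l i * (binom (l - i) k * (-z) ^ k)) * E i (i + k) := by
    rw [mem_range] at hi
    rw [hlam.tauP_eq_sum hN (K := J - i) (by omega), LinearMap.sum_apply, smul_sum]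
    refine sum_congr rfl fun k _ => ?_
    rw [LinearMap.smul_apply, smul_smul, smul_eq_mul,
      show n + l - (l - (i : ℤ)) + k = n + ((i + k : ℕ) : ℤ) by push_cast; ring]
  -- Compatibility expands `(t₂⁻¹ - z) ^ (l - i)` into `J - i` terms. Grouping by `j = i + k`, the
  -- coefficients agree with those of `t₁ ^ (m + l - j)` expanded in `t₁⁻¹ - z`, by
  -- `binom_mul_binom_sub`.
  rw [sum_congr rfl hR, ← sum_range_diag_flip J fun i k =>
    ((-1) ^ i * binom l i * (binom (l - i) k * (-z) ^ k)) * E i (i + k)]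
  refine sum_congr rfl fun j _ => ?_
  rw [X_zpow_sub_natCast z, TensorProduct.tmul_sum, map_sum, LinearMap.sum_apply,
    TensorProduct.sum_tmul, map_sum, smul_sum]
  refine sum_congr rfl fun i hi => ?_
  have hij : i ≤ j := by simpa [Nat.lt_succ_iff] using hi
  have hb := binom_mul_binom_sub l i (j - i)
  rw [Nat.add_sub_cancel' hij] at hb
  rw [Nat.add_sub_cancel' hij, TensorProduct.tmul_smul, map_smul, LinearMap.smul_apply,
    ← TensorProduct.smul_tmul', map_smul, smul_smul, smul_eq_mul]
  congr 1
  have hs : (-1 : ℂ) ^ j = (-1) ^ i * (-1) ^ (j - i) := by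
    rw [← pow_add, Nat.add_sub_cancel' hij]
  rw [neg_pow z, hs]
  linear_combination (-(-1) ^ i * (-1) ^ (j - i) * z ^ (j - i)) * hb

/-- The two expansions of the pairing with `t₁ ^ m t₂ ^ n (t₁ - t₂) ^ l` where `t₁` is near `z⁻¹` and
`t₂` is near `∞`. -/
theorem eventually_sum_oppAct_tmul_oppAct (hz : z ≠ 0) (lam : Module.Dual ℂ (W₁ ⊗[ℂ] W₂))
    (u v : V) (l m n : ℤ) (w₁ : W₁) (w₂ : W₂) :
    ∀ᶠ J in atTop,
      ∑ j ∈ range J, ((-1) ^ j * binom l j) • lam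
        (VA.oppAct M₁.Y z
          (u ⊗ₜ (RatFunc.X ^ (m + l) * (RatFunc.X⁻¹ - RatFunc.C z) ^ (j : ℤ))) w₁ ⊗ₜ
        VA.oppAct M₂.Y 0
          (v ⊗ₜ (RatFunc.X ^ (n + l) * (RatFunc.X⁻¹ - RatFunc.C z) ^ (l - j))) w₂) =
      ∑ j ∈ range J, ((-1) ^ l * ((-1) ^ j * binom l j)) • lam
        (VA.oppAct M₁.Y z (u ⊗ₜ (RatFunc.X ^ (m + j))) w₁ ⊗ₜ
          VA.oppAct M₂.Y 0 (v ⊗ₜ (RatFunc.X ^ (n + l - j))) w₂) := by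
  filter_upwards [VA.eventually_oppAct_expansion M₁.Y z u (RatFunc.X ^ (m + l)) w₁,
    VA.eventually_oppAct_expansion M₂.Y 0 v (RatFunc.X ^ (n + l)) w₂] with J h1 h2
  have hX : (RatFunc.X : RatFunc ℂ) ≠ 0 := RatFunc.X_ne_zero
  -- On `W₁`, `(t₁⁻¹) ^ (l - k)` is expanded around `t₁⁻¹ = z`; on `W₂`, `e2` expands `(t₂⁻¹ - z) ^
  -- (l - q)` around `t₂⁻¹ = 0`. The constant terms `z` and `-z` must be nonzero because the
  -- exponents may be negative.
  have e1 (k : ℕ) : VA.oppAct M₁.Y z (u ⊗ₜ (RatFunc.X ^ (m + k))) w₁ =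
      ∑ q ∈ range J, (binom (l - k) q * z ^ (l - k - q)) • VA.oppAct M₁.Y z
        (u ⊗ₜ (RatFunc.X ^ (m + l) * (RatFunc.X⁻¹ - RatFunc.C z) ^ (q : ℤ))) w₁ := by
    have := h1 z hz (l - k)
    rwa [sub_add_cancel, inv_zpow', ← zpow_add₀ hX,
      show m + l + -(l - (k : ℤ)) = m + k by ring] at this
  have e2 (q : ℕ) : VA.oppAct M₂.Y 0
      (v ⊗ₜ (RatFunc.X ^ (n + l) * (RatFunc.X⁻¹ - RatFunc.C z) ^ (l - q))) w₂ =
        ∑ k ∈ range J, (binom (l - q) k * (-z) ^ (l - q - k)) •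
          VA.oppAct M₂.Y 0 (v ⊗ₜ (RatFunc.X ^ (n + l - k))) w₂ := by
    have := h2 (-z) (neg_ne_zero.mpr hz) (l - q)
    simpa only [map_zero, sub_zero, map_neg, ← sub_eq_add_neg, inv_zpow', ← zpow_add₀ hX] using this
  simp only [e1, e2, TensorProduct.tmul_sum, TensorProduct.sum_tmul, map_sum, smul_sum,
    TensorProduct.tmul_smul, ← TensorProduct.smul_tmul', map_smul, smul_smul]
  rw [sum_comm]
  refine sum_congr rfl fun k _ => sum_congr rfl fun q _ => ?_
  congr 1
  have hb := binom_mul_binom_sub_comm l q k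
  have hs : (-1 : ℂ) ^ q * (-z) ^ (l - q - k) = (-1) ^ l * (-1) ^ k * z ^ (l - k - q) := by
    have hk : ((-1 : ℂ) ^ k)⁻¹ = (-1) ^ k := by rw [← inv_pow]; norm_num
    have hq : ((-1 : ℂ) ^ q) ≠ 0 := pow_ne_zero _ (by norm_num)
    rw [← neg_one_mul z, mul_zpow, zpow_sub₀ (by norm_num), zpow_sub₀ (by norm_num), zpow_natCast,
      zpow_natCast, div_eq_mul_inv _ ((-1 : ℂ) ^ k), hk, sub_right_comm]
    field_simp
  linear_combination (binom l q * binom (l - q) k) * hs +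
    ((-1) ^ l * (-1) ^ k * z ^ (l - k - q)) * hb

/-- The action of a product of two component operators on a compatible functional, summed up to
the pairing with `t₁ ^ m t₂ ^ n (t₁ - t₂) ^ l`. -/
theorem Compatible.eventually_sum_YP_YP (hlam : Compatible z M₁ M₂ lam) (u v : V)
    (l m n : ℤ) (w₁ : W₁) (w₂ : W₂) :
    ∀ᶠ J in atTop,
      ∑ j ∈ range J, ((-1) ^ j * binom l j) •
        YP z M₁ M₂ u (m + l - j) (YP z M₁ M₂ v (n + j) lam) (w₁ ⊗ₜ w₂) =
      lam ((∑ j ∈ range J, ((-1) ^ j * binom l j) •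
          VA.oppAct M₁.Y z (v ⊗ₜ (RatFunc.X ^ (n + l) * (RatFunc.X⁻¹ - RatFunc.C z) ^ (l - j)))
            (VA.oppAct M₁.Y z
              (u ⊗ₜ (RatFunc.X ^ (m + l) * (RatFunc.X⁻¹ - RatFunc.C z) ^ (j : ℤ))) w₁)) ⊗ₜ w₂) +
      lam (w₁ ⊗ₜ (∑ j ∈ range J, ((-1) ^ j * binom l j) •
          VA.oppAct M₂.Y 0 (v ⊗ₜ (RatFunc.X ^ (n + j)))
            (VA.oppAct M₂.Y 0 (u ⊗ₜ (RatFunc.X ^ (m + l - j))) w₂))) +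
      ∑ j ∈ range J, ((-1) ^ j * binom l j) • lam
        (VA.oppAct M₁.Y z
          (u ⊗ₜ (RatFunc.X ^ (m + l) * (RatFunc.X⁻¹ - RatFunc.C z) ^ (j : ℤ))) w₁ ⊗ₜ
        VA.oppAct M₂.Y 0
          (v ⊗ₜ (RatFunc.X ^ (n + l) * (RatFunc.X⁻¹ - RatFunc.C z) ^ (l - j))) w₂) +
      ∑ j ∈ range J, ((-1) ^ j * binom l j) • lam
        (VA.oppAct M₁.Y z (v ⊗ₜ (RatFunc.X ^ (n + j))) w₁ ⊗ₜ
          VA.oppAct M₂.Y 0 (u ⊗ₜ (RatFunc.X ^ (m + l - j))) w₂) := by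
  obtain ⟨N, hN⟩ := hlam.1 v
  filter_upwards [eventually_ge_atTop (N - n).toNat] with J hJ
  have h := hlam.sum_YP_oppAct hN u l m n w₁ w₂ (J := J) (by omega)
  have hu (j : ℕ) : YP z M₁ M₂ u (m + l - j) (YP z M₁ M₂ v (n + j) lam) (w₁ ⊗ₜ w₂) =
      YP z M₁ M₂ v (n + j) lam (VA.oppAct M₁.Y z (u ⊗ₜ (RatFunc.X ^ (m + l - j))) w₁ ⊗ₜ w₂) +
      YP z M₁ M₂ v (n + j) lam (w₁ ⊗ₜ VA.oppAct M₂.Y 0 (u ⊗ₜ (RatFunc.X ^ (m + l - j))) w₂) :=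
    tauP_apply_tmul _ _ _ _
  have hv (j : ℕ) : YP z M₁ M₂ v (n + j) lam
      (w₁ ⊗ₜ VA.oppAct M₂.Y 0 (u ⊗ₜ (RatFunc.X ^ (m + l - j))) w₂) = _ := tauP_apply_tmul _ _ _ _
  -- Only the part with `u` on `W₁` is re-expanded by compatibility; where `u` acts on `W₂`, the `v`
  -- component is evaluated as it stands.
  simp only [hu, smul_add, sum_add_distrib, h]
  simp only [hv, tauP_apply_tmul, smul_add, sum_add_distrib, TensorProduct.sum_tmul,
    TensorProduct.tmul_sum, map_sum, ← TensorProduct.smul_tmul', TensorProduct.tmul_smul, map_smul]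
  ring

/-- A compatible functional satisfies the Jacobi identity. -/
theorem Compatible.jacobiOn (hB : VA.IsMobius) (hz : z ≠ 0) (hlam : Compatible z M₁ M₂ lam)
    (u v : V) : JacobiOn (fun a n b => mode VA.Y a n b) (YP z M₁ M₂) u v lam := by
  have hzero (v : V) (n : ℤ) : YP z M₁ M₂ v n 0 = 0 := by simp [YP, tauP]
  have hzero' (n : ℤ) : YP z M₁ M₂ 0 n lam = 0 := by simp [YP, tauP]
  refine (jacobiOn_iff (hzero u) (hzero v) hzero' (hlam.1 u) (hlam.1 v)
    (exists_mode_eq_zero VA.Y u v)).mpr fun l m n => ?_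
  obtain ⟨Nu, hu⟩ := hlam.1 u
  obtain ⟨Nv, hv⟩ := hlam.1 v
  obtain ⟨Nuv, huv⟩ := exists_mode_eq_zero VA.Y u v
  filter_upwards [eventually_ge_atTop (max (Nu - m) (max (Nv - n) (Nuv - l))).toNat] with J₀ hJ₀
  refine TensorProduct.ext' fun w₁ w₂ => ?_
  -- `J₀` has to be independent of `w₁` and `w₂`, while the truncations in these lemmas depend on
  -- them. The terms between `J₀` and `J` vanish, so the sums may be lengthened to `J`.
  obtain ⟨J, hle, h12, h21, hc12, hc21, hj1, hj2⟩ := ((eventually_ge_atTop J₀).and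
    ((hlam.eventually_sum_YP_YP u v l m n w₁ w₂).and
    ((hlam.eventually_sum_YP_YP v u l n m w₁ w₂).and
    ((eventually_sum_oppAct_tmul_oppAct (M₁ := M₁) (M₂ := M₂) hz lam u v l m n w₁ w₂).and
    ((eventually_sum_oppAct_tmul_oppAct (M₁ := M₁) (M₂ := M₂) hz lam v u l n m w₁ w₂).and
    ((VA.eventually_oppAct_jacobi M₁.Y hB M₁.jacobi z u v l m n w₁).and
    (VA.eventually_oppAct_jacobi M₂.Y hB M₂.jacobi 0 u v l m n w₂))))))).exists
  rw [← sum_range_eq_of_eq_zero (F := fun j : ℕ => ((-1) ^ j * binom l j) •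
      YP z M₁ M₂ u (m + l - j) (YP z M₁ M₂ v (n + j) lam)) hle fun j hj => by
        rw [hv _ (by omega), hzero, smul_zero],
    ← sum_range_eq_of_eq_zero (F := fun j : ℕ => ((-1) ^ l * ((-1) ^ j * binom l j)) •
      YP z M₁ M₂ v (n + l - j) (YP z M₁ M₂ u (m + j) lam)) hle fun j hj => by
        rw [hu _ (by omega), hzero, smul_zero],
    ← sum_range_eq_of_eq_zero (F := fun j : ℕ => binom m j •
      YP z M₁ M₂ (mode VA.Y u (l + j) v) (m + n - j) lam) hle fun j hj => by
        rw [huv _ (by omega), hzero', smul_zero]]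
  have hX : (RatFunc.X : RatFunc ℂ) ≠ 0 := RatFunc.X_ne_zero
  have e1 (a : ℤ) (j : ℕ) : (RatFunc.X : RatFunc ℂ) ^ (a + l) *
      (RatFunc.X⁻¹ - RatFunc.C 0) ^ (l - j) = RatFunc.X ^ (a + j) := by
    rw [map_zero, sub_zero, inv_zpow', ← zpow_add₀ hX, show a + l + -(l - (j : ℤ)) = a + j by ring]
  have e2 (a : ℤ) (j : ℕ) : (RatFunc.X : RatFunc ℂ) ^ (a + l) *
      (RatFunc.X⁻¹ - RatFunc.C 0) ^ (j : ℤ) = RatFunc.X ^ (a + l - j) := by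
    rw [map_zero, sub_zero, inv_zpow', ← zpow_add₀ hX, ← sub_eq_add_neg]
  -- At `y = 0` the local coordinate is `t⁻¹`, so the weights collapse to monomials.
  simp only [e1, e2] at hj2
  have hsq : ((-1 : ℂ) ^ l) * (-1) ^ l = 1 := by
    rw [← zpow_add₀ (by norm_num), Even.neg_one_zpow ⟨l, rfl⟩]
  have hr (j : ℕ) : YP z M₁ M₂ (mode VA.Y u (l + j) v) (m + n - j) lam (w₁ ⊗ₜ w₂) = _ :=
    tauP_apply_tmul _ _ _ _
  have hj1' := congrArg (fun x => lam (x ⊗ₜ w₂)) hj1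
  have hj2' := congrArg (fun x => lam (w₁ ⊗ₜ x)) hj2
  have hR : ∑ j ∈ range J, binom m j •
      YP z M₁ M₂ (mode VA.Y u (l + j) v) (m + n - j) lam (w₁ ⊗ₜ w₂) = _ :=
    ((congrArg₂ (· + ·) hj1' hj2').trans (by
      simp only [hr, smul_add, sum_add_distrib, TensorProduct.sum_tmul, TensorProduct.tmul_sum,
        map_sum, ← TensorProduct.smul_tmul', TensorProduct.tmul_smul, map_smul])).symm
  simp only [mul_smul ((-1 : ℂ) ^ l), ← smul_sum] at hc12 hc21 hR ⊢
  simp only [LinearMap.sub_apply, LinearMap.smul_apply, LinearMap.sum_apply, h12, h21, hR]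
  have hc21' := congrArg (fun x => (-1 : ℂ) ^ l • x) hc21
  simp only [smul_smul ((-1 : ℂ) ^ l) ((-1) ^ l), hsq, one_smul] at hc21'
  simp only [TensorProduct.sub_tmul, TensorProduct.tmul_sub, map_sub,
    ← TensorProduct.smul_tmul' ((-1 : ℂ) ^ l), TensorProduct.tmul_smul ((-1 : ℂ) ^ l),
    map_smul, smul_eq_mul ((-1 : ℂ) ^ l)] at hc12 hc21' ⊢
  -- `h12`, `h21` and `hR` have already been substituted, with the Jacobi identities on `W₁` and
  -- `W₂` inside `hR`. Only the mixed parts remain, one pair for each choice of which of `u`, `v`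
  -- acts on `W₁`.
  linear_combination hc12 - hc21'

end TauP

end

end LogTensor

theorem mainTheorem1 {At : Type*} [AddCommGroup At] {A : AddSubgroup At}
    {V W₁ W₂ : Type*} [AddCommGroup V] [Module ℂ V] [AddCommGroup W₁] [Module ℂ W₁]
    [AddCommGroup W₂] [Module ℂ W₂]
    (VA : LogTensor.StronglyGradedVertexAlgebra A V)
    (M₁ : LogTensor.StronglyGradedGenModule VA W₁)
    (M₂ : LogTensor.StronglyGradedGenModule VA W₂)
    (hcase : (VA.IsMobius ∧ M₁.IsMobius ∧ M₂.IsMobius) ∨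
      ∃ (ω : V) (c : ℂ), VA.IsConformal ω c ∧ M₁.IsConformal ω c ∧ M₂.IsConformal ω c)
    (z : ℂ) (hz : z ≠ 0) (lam : Module.Dual ℂ (TensorProduct ℂ W₁ W₂))
    (hlam : LogTensor.Compatible z M₁ M₂ lam) (u v : V) :
    LogTensor.JacobiOn (fun a n b => LogTensor.mode VA.Y a n b) (LogTensor.YP z M₁ M₂) u v lam := by
  refine LogTensor.Compatible.jacobiOn ?_ hz hlam u v
  rcases hcase with h | ⟨ω, c, h, -⟩
  · exact h.1
  · exact h.isMobius
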